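/- Let $\Phi$ be an irreducible (reduced, crystallographic) root system of rank $\ell$ in a real vector space $V$, with a positive system $\Phi^+$ and the corresponding simple roots $\alpha_1,\dots,\alpha_\ell$. Let $h=1+c_1+\dots+c_\ell$ be its Coxeter number, where $c_1\alpha_1+\dots+c_\ell\alpha_\ell$ is the highest root. Regard roots as linear functionals on the dual space $V^*$ (identified with $V$ if $V$ is Euclidean), and let $L=\{x\in V^* : \alpha_i(x)\in\mathbb Z,\ 1\le i\le \ell\}$ be the coweight lattice. For integers $a\le b$ let $$\mathcal A_\Phi^{[a,b]}=\{H_{\alpha,j} : \alpha\in\Phi^+,\ j\in\mathbb Z,\ a\le j\le b\},\qquad H_{\alpha,j}=\{x\in V^* : \alpha(x)=j\}.$$ A function $f:\mathbb Z\to\mathbb Z$ is a quasi-polynomial with gcd-property if there are an integer $m>0$ and polynomials $g_1,\dots,g_m\in\mathbb Z[t]$ such that $f(q)=g_r(q)$ whenever $q\equiv r \pmod m$, and $g_r=g_s$ whenever $\gcd(r,m)=\gcd(s,m)$. The characteristic quasi-polynomial $\chi_{\mathrm{quasi}}(\mathcal A_\Phi^{[a,b]},\cdot)$ is the unique quasi-polynomial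 with gcd-property such that, for all sufficiently large integers $q$, $$\chi_{\mathrm{quasi}}(\mathcal A_\Phi^{[a,b]},q)=\#\{\bar x\in L/qL : \alpha(x)\not\equiv j \pmod q \text{ for all } \alpha\in\Phi^+ \text{ and all integers } j \text{ with } a\le j\le b\}.$$ **Theorem.** Let $n\ge 1$ and $k\ge 0$ be integers. Then the characteristic quasi-polynomials of $\mathcal A_\Phi^{[1,n]}$ and $\mathcal A_\Phi^{[1-k,n+k]}$ exist, and for all $q\in\mathbb Z$ $$\chi_{\mathrm{quasi}}\bigl(\mathcal A_\Phi^{[1-k,n+k]},q\bigr)=\chi_{\mathrm{quasi}}\bigl(\mathcal A_\Phi^{[1,n]},\,q-kh\bigr).$$ -/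

import Mathlib

/-! ### Quasi-polynomials and the characteristic quasi-polynomial of an integral arrangement -/

/-- `f : ℤ → ℤ` is a quasi-polynomial with the gcd-property: for some modulus `m > 0` there are
polynomials `g r ∈ ℤ[t]`, `1 ≤ r ≤ m`, with `f q = g r (q)` whenever `q ≡ r mod m`, and `g r`
depends on `r` only through `gcd(r, m)`. -/
def IsQuasiPolynomialGcd (f : ℤ → ℤ) : Prop :=
  ∃ m : ℕ, 0 < m ∧ ∃ g : ℕ → Polynomial ℤ,
    (∀ r ∈ Finset.Icc 1 m, ∀ q : ℤ, q ≡ (r : ℤ) [ZMOD (m : ℤ)] → f q = (g r).eval q) ∧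
    (∀ r ∈ Finset.Icc 1 m, ∀ s ∈ Finset.Icc 1 m, Nat.gcd r m = Nat.gcd s m → g r = g s)

/-- The sublattice `qL` of a lattice `L`. -/
def mulSublattice (L : Type*) [AddCommGroup L] (q : ℕ) : Submodule ℤ L :=
  LinearMap.range (LinearMap.lsmul ℤ L (q : ℤ))

/-- An integral affine arrangement on a lattice `L` is given by a set `A` of pairs `(α, k)` with
`α ∈ Hom(L, ℤ)` and `k ∈ ℤ`, the pair standing for the hyperplane `α = k` of `L ⊗ ℝ`.
`modComplement A q` is the complement of its reduction mod `q`: the set of classes of `L / qL`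
of the `x` with `α x ≢ k mod q` for all `(α, k) ∈ A`. (For the classes this condition does not
depend on the representative.) -/
def modComplement {L : Type*} [AddCommGroup L] (A : Set (Module.Dual ℤ L × ℤ)) (q : ℕ) :
    Set (L ⧸ mulSublattice L q) :=
  {y | ∃ x : L, Submodule.Quotient.mk x = y ∧ ∀ p ∈ A, ¬ p.1 x ≡ p.2 [ZMOD (q : ℤ)]}

/-- `f` is the characteristic quasi-polynomial of the arrangement `A`: a quasi-polynomial with the
gcd-property that counts `modComplement A q` for all large `q`. -/
def IsCharQuasiPolynomial {L : Type*} [AddCommGroup L] (A : Set (Module.Dual ℤ L × ℤ))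
    (f : ℤ → ℤ) : Prop :=
  IsQuasiPolynomialGcd f ∧
    ∃ q₀ : ℕ, ∀ q : ℕ, q₀ < q →
      (modComplement A q).Finite ∧ ((modComplement A q).ncard : ℤ) = f (q : ℤ)

/-- Two quasi-polynomials that agree at all large integers are equal. -/
theorem IsQuasiPolynomialGcd.eq_of_eventually_eq {f f' : ℤ → ℤ} (hf : IsQuasiPolynomialGcd f)
    (hf' : IsQuasiPolynomialGcd f') (q₀ : ℕ) (h : ∀ q : ℕ, q₀ < q → f (q : ℤ) = f' (q : ℤ)) :
    f = f' := by
  obtain ⟨m, hm, g, hg, -⟩ := hf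
  obtain ⟨m', hm', g', hg', -⟩ := hf'
  have key : ∀ (m : ℕ), 0 < m → ∀ q : ℤ, ∃ r ∈ Finset.Icc 1 m, q ≡ (r : ℤ) [ZMOD (m : ℤ)] := by
    intro m hm q
    have hm0 : (0 : ℤ) < m := by exact_mod_cast hm
    have h1 := Int.emod_nonneg (q - 1) hm0.ne'
    have h2 := Int.emod_lt_of_pos (q - 1) hm0
    refine ⟨((q - 1) % m).toNat + 1, ?_, ?_⟩
    · rw [Finset.mem_Icc]; omega
    · push_cast
      rw [Int.toNat_of_nonneg h1]
      have := ((Int.mod_modEq (q - 1) (m : ℤ)).add_right 1).symm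
      simpa using this
  funext q
  obtain ⟨r, hr, hqr⟩ := key m hm q
  obtain ⟨s, hs, hqs⟩ := key m' hm' q
  rw [hg r hr q hqr, hg' s hs q hqs]
  have hmm : (0 : ℤ) < (m : ℤ) * m' := by positivity
  have hpoly : g r = g' s := by
    refine Polynomial.eq_of_infinite_eval_eq _ _ ?_
    let F : ℕ → ℤ := fun t => q + ((m : ℤ) * m') * (q.natAbs + q₀ + 1 + t : ℕ)
    have hF : Function.Injective F := by
      intro a b hab
      have h3 : ((m : ℤ) * m') * (q.natAbs + q₀ + 1 + a : ℕ)
          = ((m : ℤ) * m') * (q.natAbs + q₀ + 1 + b : ℕ) := by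
        simpa [F] using hab
      have h4 := mul_left_cancel₀ hmm.ne' h3
      omega
    refine (Set.infinite_range_of_injective hF).mono ?_
    rintro _ ⟨t, rfl⟩
    have hbig : (q₀ : ℤ) < F t := by
      have h5 : ((q.natAbs + q₀ + 1 + t : ℕ) : ℤ)
          ≤ ((m : ℤ) * m') * (q.natAbs + q₀ + 1 + t : ℕ) :=
        le_mul_of_one_le_left (by positivity) hmm
      simp only [F]
      omega
    have h6 : F t ≡ r [ZMOD (m : ℤ)] := by
      refine Int.ModEq.trans ?_ hqr
      simp only [F, mul_assoc]
      exact (Int.modEq_iff_dvd.2 ⟨_, by rw [add_sub_cancel_left]⟩ : q ≡ _ [ZMOD (m : ℤ)]).symm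
    have h7 : F t ≡ s [ZMOD (m' : ℤ)] := by
      refine Int.ModEq.trans ?_ hqs
      simp only [F, mul_comm (m : ℤ), mul_assoc]
      exact (Int.modEq_iff_dvd.2 ⟨_, by rw [add_sub_cancel_left]⟩ : q ≡ _ [ZMOD (m' : ℤ)]).symm
    have h8 := h (F t).toNat (by omega)
    rw [Int.toNat_of_nonneg (by omega)] at h8
    show (g r).eval (F t) = (g' s).eval (F t)
    rw [← hg r hr _ h6, ← hg' s hs _ h7, h8]
  rw [hpoly]

/-- The characteristic quasi-polynomial is unique. -/
theorem IsCharQuasiPolynomial.unique {L : Type*} [AddCommGroup L]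
    {A : Set (Module.Dual ℤ L × ℤ)} {f f' : ℤ → ℤ} (hf : IsCharQuasiPolynomial A f)
    (hf' : IsCharQuasiPolynomial A f') : f = f' := by
  obtain ⟨hq, a, ha⟩ := hf
  obtain ⟨hq', a', ha'⟩ := hf'
  refine hq.eq_of_eventually_eq hq' (max a a') fun q hlt => ?_
  rw [← (ha q (lt_of_le_of_lt (le_max_left _ _) hlt)).2,
    ← (ha' q (lt_of_le_of_lt (le_max_right _ _) hlt)).2]

/-- The characteristic quasi-polynomial `χ_quasi(A, ·)`: the unique function with
`IsCharQuasiPolynomial A`, if there is one. -/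
noncomputable def charQuasiPolynomial {L : Type*} [AddCommGroup L]
    (A : Set (Module.Dual ℤ L × ℤ)) : ℤ → ℤ :=
  Classical.epsilon (IsCharQuasiPolynomial A)

/-! ### Root systems: coweight lattice, Coxeter number, truncated affine Weyl arrangements

A root system `P` has its roots in `M` and its coroots in the dual space `N`; `P.root' i` is the
`i`-th root as a linear functional on `N`. In the Euclidean picture `N` is identified with `M`, and
`P.root' i x` is the inner product of the `i`-th root with `x`. -/

/-- The coweight lattice: the `x` at which all simple roots are integral. -/
def coweightLattice {ι M N : Type*} [AddCommGroup M] [Module ℝ M] [AddCommGroup N] [Module ℝ N]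
    {P : RootPairing ι ℝ M N} (b : P.Base) : Submodule ℤ N where
  carrier := {x | ∀ i ∈ b.support, ∃ z : ℤ, P.root' i x = (z : ℝ)}
  zero_mem' := fun i _ => ⟨0, by simp⟩
  add_mem' := by
    intro x y hx hy i hi
    obtain ⟨a, ha⟩ := hx i hi
    obtain ⟨c, hc⟩ := hy i hi
    exact ⟨a + c, by rw [map_add, ha, hc, Int.cast_add]⟩
  smul_mem' := by
    intro m x hx i hi
    obtain ⟨a, ha⟩ := hx i hi
    exact ⟨m * a, by rw [map_zsmul, ha, zsmul_eq_mul, Int.cast_mul]⟩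

/-- Every root is integral on the coweight lattice. -/
theorem exists_int_root'_eq {ι M N : Type*} [AddCommGroup M] [Module ℝ M] [AddCommGroup N]
    [Module ℝ N] {P : RootPairing ι ℝ M N} (b : P.Base) (i : ι) (x : coweightLattice b) :
    ∃ z : ℤ, P.root' i (x : N) = (z : ℝ) := by
  have hspan := b.root_mem_span_int i
  change ∃ z : ℤ, P.toLinearMap (P.root i) (x : N) = (z : ℝ)
  generalize P.root i = v at hspan
  induction hspan using Submodule.span_induction with
  | mem v hv =>
    obtain ⟨j, hj, rfl⟩ := hv
    exact x.2 j hj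
  | zero => exact ⟨0, by simp⟩
  | add u v _ _ hu hv =>
    obtain ⟨a, ha⟩ := hu
    obtain ⟨c, hc⟩ := hv
    exact ⟨a + c, by rw [map_add, LinearMap.add_apply, ha, hc, Int.cast_add]⟩
  | smul m v _ hv =>
    obtain ⟨a, ha⟩ := hv
    exact ⟨m * a, by rw [map_zsmul, LinearMap.smul_apply, ha, zsmul_eq_mul, Int.cast_mul]⟩

/-- The `i`-th root as an integral functional on the coweight lattice (the floor only turns the
integer-valued real number into an integer). -/
noncomputable def rootFunctional {ι M N : Type*} [AddCommGroup M] [Module ℝ M] [AddCommGroup N]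
    [Module ℝ N] {P : RootPairing ι ℝ M N} (b : P.Base) (i : ι) :
    Module.Dual ℤ (coweightLattice b) where
  toFun x := ⌊P.root' i (x : N)⌋
  map_add' x y := by
    obtain ⟨a, ha⟩ := exists_int_root'_eq b i x
    rw [Submodule.coe_add, map_add, ha, Int.floor_intCast_add, Int.floor_intCast]
  map_smul' m x := by
    obtain ⟨a, ha⟩ := exists_int_root'_eq b i x
    rw [Submodule.coe_smul, map_zsmul, ha, zsmul_eq_mul, ← Int.cast_mul, Int.floor_intCast,
      Int.floor_intCast]
    simp

/-- `rootFunctional` has the same values as the root. -/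
theorem coe_rootFunctional_apply {ι M N : Type*} [AddCommGroup M] [Module ℝ M] [AddCommGroup N]
    [Module ℝ N] {P : RootPairing ι ℝ M N} (b : P.Base) (i : ι) (x : coweightLattice b) :
    (rootFunctional b i x : ℝ) = P.root' i (x : N) := by
  obtain ⟨a, ha⟩ := exists_int_root'_eq b i x
  change ((⌊P.root' i (x : N)⌋ : ℤ) : ℝ) = P.root' i (x : N)
  rw [ha, Int.floor_intCast]

/-- The Coxeter number `h = 1 + c₁ + ⋯ + c_ℓ` of an irreducible root system, where
`c₁ α₁ + ⋯ + c_ℓ α_ℓ` is the highest root, i.e. the root of the largest height. -/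
noncomputable def coxeterNumber {ι M N : Type*} [AddCommGroup M] [Module ℝ M] [AddCommGroup N]
    [Module ℝ N] {P : RootPairing ι ℝ M N} (b : P.Base) : ℤ :=
  1 + ⨆ i : ι, b.height i

/-- The truncated affine Weyl arrangement: all hyperplanes `α = k` with `α` a positive root and
`k` an integer with `lo ≤ k ≤ hi`. -/
def truncatedAffineArrangement {ι M N : Type*} [AddCommGroup M] [Module ℝ M] [AddCommGroup N]
    [Module ℝ N] {P : RootPairing ι ℝ M N} (b : P.Base) (lo hi : ℤ) :
    Set (Module.Dual ℤ (coweightLattice b) × ℤ) :=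
  {p | ∃ i : ι, b.IsPos i ∧ ∃ k : ℤ, lo ≤ k ∧ k ≤ hi ∧ p = (rootFunctional b i, k)}

/-! Write `ρ` for `weylCoweight b`, `θ` for the highest root and `h = 1 + ht θ`. The points counted
for `q` and for `q - k h` are matched by an explicit bijection.

Every lattice point is `x = w y + q t` with `w` a symmetry of the roots, `t` a lattice point and `y`
in the alcove `α_j ≥ 0`, `θ ≤ q`. Moreover `α_j(y) ≥ 1` can be arranged whenever `w α_j` is
positive, and `θ(y) ≤ q - 1` whenever `w θ` is negative (`exists_inAlcove`). This half-open choice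
comes from moving `x` slightly in the direction `-ρ`. For such `y`, avoiding the levels `1 - k, …, n
+ k` modulo `q` means exactly that `y` has distance at least `k` from every wall of the alcove, and
at least `k + n + 1` from the walls where strictness was imposed (`InAlcove.avoids_iff`). Testing
the walls suffices: the bounds for all other roots follow, since roots are sign-coherent
combinations of simple roots bounded by `θ`.

As `α_j(ρ) = 1` and `θ(ρ) = h - 1`, passing from `(y, q)` to `(y - k ρ, q - k h)` lowers the
distance `k` to `0` and keeps `n` (`InAlcove.sub_smul_weylCoweight_iff`). On `x` this is `x ↦ x - k
v` with `v = w ρ + h t`. The triple `(w, t, y)` need not be unique, but `v` is, because `ρ` is the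
only lattice point with all `α_j ≥ 1` and `θ ≤ h - 1` (`InAlcove.map_weylCoweight_eq`). Hence the
two counts agree for large `q` (`ncard_modComplement_shift`).

Existence is a separate matter: deletion reduces it to counting solutions of linear congruences,
which Smith normal form evaluates. Since both functions are polynomial on residue classes, the
identity for large `q` extends to all integers. -/

/-! ### Functions that are polynomial on each gcd class -/

/-- `f : ℤ → ℤ` takes at `q` the value of a polynomial that depends only on `gcd(q, m)`. -/
def IsGcdPolynomial (f : ℤ → ℤ) : Prop :=
  ∃ m : ℕ, 0 < m ∧ ∃ G : ℕ → Polynomial ℤ, ∀ q : ℤ, f q = (G (Int.gcd q m)).eval q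

namespace IsGcdPolynomial

theorem eval (p : Polynomial ℤ) : IsGcdPolynomial fun q => p.eval q :=
  ⟨1, one_pos, fun _ => p, fun _ => rfl⟩

/-- `gcd(q, m m')` determines both `gcd(q, m)` and `gcd(q, m')`, so two functions can be put over
the common modulus `m m'`. -/
theorem map₂ (op : Polynomial ℤ → Polynomial ℤ → Polynomial ℤ) (op' : ℤ → ℤ → ℤ)
    (hop : ∀ a b q, (op a b).eval q = op' (a.eval q) (b.eval q)) {f f' : ℤ → ℤ}
    (hf : IsGcdPolynomial f) (hf' : IsGcdPolynomial f') :
    IsGcdPolynomial fun q => op' (f q) (f' q) := by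
  obtain ⟨m, hm, G, hG⟩ := hf
  obtain ⟨m', hm', G', hG'⟩ := hf'
  refine ⟨m * m', by positivity, fun d => op (G (Nat.gcd d m)) (G' (Nat.gcd d m')), fun q => ?_⟩
  have h1 : Nat.gcd (Int.gcd q ((m * m' : ℕ) : ℤ)) m = Int.gcd q m := by
    rw [Int.gcd_def, Int.gcd_def, Int.natAbs_natCast, Int.natAbs_natCast, Nat.gcd_assoc,
      Nat.gcd_eq_right (Dvd.intro _ rfl)]
  have h2 : Nat.gcd (Int.gcd q ((m * m' : ℕ) : ℤ)) m' = Int.gcd q m' := by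
    rw [Int.gcd_def, Int.gcd_def, Int.natAbs_natCast, Int.natAbs_natCast, Nat.gcd_assoc,
      Nat.gcd_eq_right (Dvd.intro_left _ rfl)]
  simp only [hop, h1, h2, hG, hG']

theorem sub {f f' : ℤ → ℤ} (hf : IsGcdPolynomial f) (hf' : IsGcdPolynomial f') :
    IsGcdPolynomial fun q => f q - f' q :=
  map₂ (· - ·) (· - ·) (fun _ _ _ => by simp) hf hf'

theorem mul {f f' : ℤ → ℤ} (hf : IsGcdPolynomial f) (hf' : IsGcdPolynomial f') :
    IsGcdPolynomial fun q => f q * f' q :=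
  map₂ (· * ·) (· * ·) (fun _ _ _ => by simp) hf hf'

theorem prod {σ : Type*} (s : Finset σ) {f : σ → ℤ → ℤ} (hf : ∀ i, IsGcdPolynomial (f i)) :
    IsGcdPolynomial fun q => ∏ i ∈ s, f i q := by
  classical
  induction s using Finset.induction_on with
  | empty => simpa using eval 1
  | insert a s ha ih => simpa only [Finset.prod_insert ha] using (hf a).mul ih

theorem isQuasiPolynomialGcd {f : ℤ → ℤ} (hf : IsGcdPolynomial f) : IsQuasiPolynomialGcd f := by
  obtain ⟨m, hm, G, hG⟩ := hf
  refine ⟨m, hm, fun r => G (Nat.gcd r m), fun r _ q hq => ?_, fun r _ s _ h => by simp only [h]⟩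
  have : Int.gcd q m = Nat.gcd r m := by
    rw [← Int.gcd_emod, show q % m = r % m from hq, Int.gcd_emod]
    simp
  rw [hG, this]

end IsGcdPolynomial

/-! ### Counting solutions of linear congruences -/

/-- The number of solutions of `a x = c` in `ZMod q`. -/
theorem card_filter_zmod_mul_eq (a c : ℤ) (q : ℕ) [NeZero q] :
    (Finset.univ.filter fun u : ZMod q => (a : ZMod q) * u = (c : ZMod q)).card =
      if ((Int.gcd q a : ℕ) : ℤ) ∣ c then Int.gcd q a else 0 := by
  classical
  let F : ZMod q →+ ZMod q := AddMonoidHom.mulLeft (a : ZMod q)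
  have hFa : ∀ u, F u = (a : ZMod q) * u := fun u => rfl
  have hsol : (∃ u : ZMod q, (a : ZMod q) * u = (c : ZMod q)) ↔ ((Int.gcd q a : ℕ) : ℤ) ∣ c := by
    constructor
    · rintro ⟨u, hu⟩
      obtain ⟨u, rfl⟩ := ZMod.intCast_surjective u
      rw [← Int.cast_mul, ZMod.intCast_eq_intCast_iff_dvd_sub] at hu
      have h1 := (Int.gcd_dvd_left (q : ℤ) a).trans hu
      have h2 := (Int.gcd_dvd_right (q : ℤ) a).mul_right u
      simpa using h1.add h2
    · rintro ⟨w, hw⟩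
      refine ⟨((Int.gcdB q a * w : ℤ) : ZMod q), ?_⟩
      rw [← Int.cast_mul, ZMod.intCast_eq_intCast_iff_dvd_sub, hw, Int.gcd_eq_gcd_ab]
      exact ⟨Int.gcdA q a * w, by ring⟩
  split_ifs with h
  -- Nonempty fibres of a homomorphism have the size of its kernel, and multiplication by `a` on a
  -- cyclic group of order `q` has kernel of order `gcd(q, |a|)`.
  · obtain ⟨u₀, hu₀⟩ := hsol.2 h
    have h1 := AddMonoidHom.card_fiber_eq_of_mem_range F (x := (c : ZMod q)) (y := 0)
      ⟨u₀, hu₀⟩ ⟨0, map_zero _⟩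
    simp only [hFa] at h1
    rw [h1]
    have h2 := IsAddCyclic.card_nsmulAddMonoidHom_ker (G := ZMod q) a.natAbs
    rw [Nat.card_zmod] at h2
    have h3 : Int.gcd q a = q.gcd a.natAbs := by simp [Int.gcd_def]
    rw [h3, ← h2, ← Fintype.card_subtype, ← Nat.card_eq_fintype_card]
    refine Nat.card_congr (Equiv.subtypeEquivRight fun u => ?_)
    rw [AddMonoidHom.mem_ker, nsmulAddMonoidHom_apply, nsmul_eq_mul]
    rcases Int.natAbs_eq a with ha | ha
    · rw [ha]; simp
    · rw [ha]; simp
  · rw [Finset.card_eq_zero, Finset.filter_eq_empty_iff]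
    exact fun u _ hu => h (hsol.1 ⟨u, hu⟩)

theorem isGcdPolynomial_card_zmod_mul_eq (a c : ℤ) (ha : a ≠ 0) :
    IsGcdPolynomial fun q => ((if ((Int.gcd q a : ℕ) : ℤ) ∣ c then Int.gcd q a else 0 : ℕ) : ℤ) := by
  refine ⟨a.natAbs, Int.natAbs_pos.2 ha,
    fun d => Polynomial.C (if (d : ℤ) ∣ c then (d : ℤ) else 0), fun q => ?_⟩
  have : Int.gcd q (a.natAbs : ℤ) = Int.gcd q a := by
    rw [Int.gcd_def, Int.gcd_def, Int.natAbs_natCast]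
  rw [this, Polynomial.eval_C]
  simp

/-- A subset of `L / qL` given by a condition on representatives can be counted in any quotient of
`L` with kernel `qL`. -/
theorem ncard_mk_image_eq {L Z : Type*} [AddCommGroup L] [AddCommGroup Z] (q : ℕ) (π : L →ₗ[ℤ] Z)
    (hπ : LinearMap.ker π = mulSublattice L q) (p : L → Prop) (T : Set Z)
    (hsurj : Function.Surjective π) (hT : ∀ x, p x ↔ π x ∈ T) :
    {y : L ⧸ mulSublattice L q | ∃ x, Submodule.Quotient.mk x = y ∧ p x}.ncard = T.ncard := by
  have hinj : Function.Injective ((mulSublattice L q).liftQ π hπ.ge) := by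
    rw [← LinearMap.ker_eq_bot]
    exact Submodule.ker_liftQ_eq_bot _ _ _ hπ.le
  rw [← Set.ncard_image_of_injective _ hinj]
  congr 1
  ext z
  constructor
  · rintro ⟨_, ⟨x, rfl, hx⟩, rfl⟩
    exact (hT x).1 hx
  · intro hz
    obtain ⟨x, rfl⟩ := hsurj z
    exact ⟨_, ⟨x, rfl, (hT x).2 hz⟩, rfl⟩

theorem mem_mulSublattice {L : Type*} [AddCommGroup L] {q : ℕ} {x : L} :
    x ∈ mulSublattice L q ↔ ∃ y : L, x = (q : ℤ) • y :=
  ⟨fun ⟨y, hy⟩ => ⟨y, hy.symm⟩, fun ⟨y, hy⟩ => ⟨y, hy.symm⟩⟩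

/-- The sublattice `q ℤ^σ` is the same in every basis, so a system of congruences may be read off in
the Smith basis. -/
theorem Module.Basis.forall_dvd_repr_iff {σ : Type*} [Finite σ]
    (bM : Module.Basis σ ℤ (σ → ℤ)) (q : ℤ) (w : σ → ℤ) :
    (∀ l, q ∣ bM.repr w l) ↔ ∀ p, q ∣ w p := by
  cases nonempty_fintype σ
  constructor
  · intro h p
    rw [← bM.sum_repr w, Finset.sum_apply]
    exact Finset.dvd_sum fun l _ => (h l).mul_right _
  · intro h l
    choose w' hw' using h
    rw [show w = q • w' from funext hw', map_smul]
    exact Dvd.intro _ rfl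

/-- Smith normal form of a homomorphism into `ℤ^σ`: in suitable coordinates `(u, v)` of `L`
and a suitable basis `bM` of `ℤ^σ` it is diagonal. -/
theorem exists_smith_coordinates {L σ : Type*} [AddCommGroup L] [Module.Free ℤ L]
    [Module.Finite ℤ L] [Finite σ] (φ : L →ₗ[ℤ] (σ → ℤ)) :
    ∃ (m r : ℕ) (E : L ≃ₗ[ℤ] (Fin m → ℤ) × (Fin r → ℤ)) (bM : Module.Basis σ ℤ (σ → ℤ))
      (f : Fin r ↪ σ) (a : Fin r → ℤ), (∀ i, a i ≠ 0) ∧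
      (∀ x i, bM.repr (φ x) (f i) = a i * (E x).2 i) ∧
      ∀ x l, l ∉ Set.range f → bM.repr (φ x) l = 0 := by
  obtain ⟨r, snf⟩ := (LinearMap.range φ).smithNormalForm (Pi.basisFun ℤ σ)
  -- A section of `φ` over its range splits `L` as kernel times range: the kernel supplies the
  -- unconstrained coordinates, the range the diagonal ones.
  obtain ⟨s, hs⟩ := LinearMap.exists_rightInverse_of_surjective φ.rangeRestrict
    (LinearMap.range_rangeRestrict φ)
  have hs' : ∀ z, φ (s z) = z := fun z => congrArg Subtype.val (LinearMap.congr_fun hs z)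
  obtain ⟨m, κ⟩ := (LinearMap.ker φ).basisOfPid (Module.Free.chooseBasis ℤ L)
  let E₀ : L ≃ₗ[ℤ] LinearMap.ker φ × LinearMap.range φ :=
    LinearEquiv.ofLinearMap
      (LinearMap.prod (LinearMap.codRestrict _ (LinearMap.id - s ∘ₗ φ.rangeRestrict)
        (fun x => by simp [LinearMap.mem_ker, hs'])) φ.rangeRestrict)
      (LinearMap.coprod (LinearMap.ker φ).subtype s)
      (by
        have h1 : ∀ z : LinearMap.ker φ, φ.rangeRestrict z = 0 := fun z => Subtype.ext z.2
        refine LinearMap.ext fun z => Prod.ext (Subtype.ext ?_) (Subtype.ext ?_)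
        · have h2 : φ.rangeRestrict (z.1 + s z.2) = z.2 := by
            rw [map_add, h1, zero_add]
            exact LinearMap.congr_fun hs z.2
          change (z.1 + s z.2 : L) - s (φ.rangeRestrict (z.1 + s z.2)) = z.1
          rw [h2, add_sub_cancel_right]
        · change φ (z.1 + s z.2) = z.2
          rw [map_add, hs', show φ z.1 = 0 from z.1.2, zero_add])
      (by ext x; simp)
  have hE₀ : ∀ x, ((E₀ x).2 : σ → ℤ) = φ x := fun x => rfl
  refine ⟨m, r, E₀.trans (κ.equivFun.prodCongr snf.bN.equivFun), snf.bM, snf.f, snf.a, ?_, ?_, ?_⟩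
  · intro i hi
    have := snf.snf i
    rw [hi, zero_smul] at this
    exact snf.bN.ne_zero i (Subtype.ext this)
  · intro x i
    have := snf.repr_apply_embedding_eq_repr_smul (m := φ.rangeRestrict x) (i := i)
    rw [map_smul, Finsupp.smul_apply, smul_eq_mul] at this
    exact this
  · intro x l hl
    exact snf.repr_eq_zero_of_notMem_range (φ.rangeRestrict x) hl

/-- In Smith coordinates the system decouples into congruences `a_i v_i ≡ c'_i`, with the `m` kernel
coordinates free. The count is thus `q ^ m` times a product of factors depending only on `gcd(q,
a_i)`. -/
theorem exists_card_solutions {L : Type*} [AddCommGroup L] [Module.Free ℤ L] [Module.Finite ℤ L]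
    (B : Finset (Module.Dual ℤ L × ℤ)) :
    ∃ f : ℤ → ℤ, IsGcdPolynomial f ∧ ∃ q₀ : ℕ, ∀ q : ℕ, q₀ < q →
      (({y : L ⧸ mulSublattice L q | ∃ x, Submodule.Quotient.mk x = y ∧
        ∀ p ∈ B, p.1 x ≡ p.2 [ZMOD (q : ℤ)]}.ncard : ℕ) : ℤ) = f q := by
  classical
  let φ : L →ₗ[ℤ] (B → ℤ) := LinearMap.pi fun p => p.1.1
  let c : B → ℤ := fun p => p.1.2
  obtain ⟨m, r, E, bM, e, a, ha, hE, hE'⟩ := exists_smith_coordinates φ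
  let c' := bM.repr c
  have hdvd : ∀ (q : ℕ) x, (∀ p ∈ B, p.1 x ≡ p.2 [ZMOD (q : ℤ)]) ↔
      ∀ l, (q : ℤ) ∣ c' l - bM.repr (φ x) l := by
    intro q x
    have h := bM.forall_dvd_repr_iff (q : ℤ) (c - φ x)
    rw [map_sub] at h
    refine Iff.trans ?_ h.symm
    simp only [Int.modEq_iff_dvd]
    exact ⟨fun h p => h p.1 p.2, fun h p hp => h ⟨p, hp⟩⟩
  -- Rows outside the range of `e` read `c'_l ≡ 0`. If some such `c'_l` is nonzero, the system has
  -- no solution once `q > |c'_l|`; this is why only large `q` are considered.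
  by_cases hc : ∀ l, l ∉ Set.range e → c' l = 0
  · refine ⟨fun q => q ^ m * ∏ i, ((if ((Int.gcd q (a i) : ℕ) : ℤ) ∣ c' (e i)
      then Int.gcd q (a i) else 0 : ℕ) : ℤ), ?_, 0, fun q hq => ?_⟩
    · have := IsGcdPolynomial.eval (Polynomial.X ^ m)
      simp only [Polynomial.eval_pow, Polynomial.eval_X] at this
      exact this.mul (IsGcdPolynomial.prod _ fun i => isGcdPolynomial_card_zmod_mul_eq _ _ (ha i))
    · have : NeZero q := ⟨hq.ne'⟩
      let ρ : L →ₗ[ℤ] (Fin m → ZMod q) × (Fin r → ZMod q) :=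
        (LinearMap.prodMap
          (LinearMap.pi fun i => (Int.castAddHom (ZMod q)).toIntLinearMap ∘ₗ LinearMap.proj i)
          (LinearMap.pi fun i => (Int.castAddHom (ZMod q)).toIntLinearMap ∘ₗ LinearMap.proj i))
            ∘ₗ E.toLinearMap
      have hρ1 : ∀ x i, (ρ x).1 i = ((E x).1 i : ZMod q) := fun x i => rfl
      have hρ2 : ∀ x i, (ρ x).2 i = ((E x).2 i : ZMod q) := fun x i => rfl
      let T : Finset ((Fin m → ZMod q) × (Fin r → ZMod q)) :=
        Finset.univ ×ˢ Fintype.piFinset fun i => Finset.univ.filter fun u : ZMod q =>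
          (a i : ZMod q) * u = (c' (e i) : ZMod q)
      rw [ncard_mk_image_eq q ρ ?_ _ (T : Set _) ?_ ?_, Set.ncard_coe_finset]
      · simp [T, Fintype.card_piFinset, card_filter_zmod_mul_eq]
      · ext x
        rw [LinearMap.mem_ker, mem_mulSublattice]
        constructor
        · intro hx
          have h1 : ∀ i, (q : ℤ) ∣ (E x).1 i := fun i => by
            rw [← ZMod.intCast_zmod_eq_zero_iff_dvd, ← hρ1, hx]
            rfl
          have h2 : ∀ i, (q : ℤ) ∣ (E x).2 i := fun i => by
            rw [← ZMod.intCast_zmod_eq_zero_iff_dvd, ← hρ2, hx]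
            rfl
          choose w1 hw1 using h1
          choose w2 hw2 using h2
          refine ⟨E.symm (w1, w2), ?_⟩
          rw [← map_smul, LinearEquiv.eq_symm_apply]
          exact Prod.ext (funext hw1) (funext hw2)
        · rintro ⟨y, rfl⟩
          rw [map_smul]
          refine Prod.ext (funext fun i => ?_) (funext fun i => ?_)
          · simp [hρ1]
          · simp [hρ2]
      · rintro ⟨u, v⟩
        choose u' hu' using fun i => ZMod.intCast_surjective (u i)
        choose v' hv' using fun i => ZMod.intCast_surjective (v i)
        refine ⟨E.symm (u', v'), Prod.ext (funext fun i => ?_) (funext fun i => ?_)⟩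
        · rw [hρ1, LinearEquiv.apply_symm_apply, hu']
        · rw [hρ2, LinearEquiv.apply_symm_apply, hv']
      · intro x
        rw [hdvd]
        simp only [T, Finset.coe_product, Finset.coe_univ, Set.mem_prod, Set.mem_univ, true_and,
          Finset.mem_coe, Fintype.mem_piFinset, Finset.mem_filter, Finset.mem_univ]
        constructor
        · intro h i
          rw [hρ2, ← Int.cast_mul, ← hE, ZMod.intCast_eq_intCast_iff_dvd_sub]
          exact h (e i)
        · intro h l
          by_cases hl : l ∈ Set.range e
          · obtain ⟨i, rfl⟩ := hl
            rw [← ZMod.intCast_eq_intCast_iff_dvd_sub, hE, Int.cast_mul, ← hρ2]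
            exact h i
          · rw [hc l hl, hE' x l hl]
            simp
  · push Not at hc
    obtain ⟨l, hl, hl0⟩ := hc
    refine ⟨fun q => 0, ?_, (c' l).natAbs, fun q hq => ?_⟩
    · simpa using IsGcdPolynomial.eval 0
    · rw [Nat.cast_eq_zero]
      refine (congrArg Set.ncard ?_).trans (Set.ncard_empty _)
      rw [Set.eq_empty_iff_forall_notMem]
      rintro _ ⟨x, -, hx⟩
      have h1 := (hdvd q x).1 hx l
      rw [hE' x l hl, sub_zero] at h1
      have := Int.natAbs_dvd_natAbs.2 h1
      have := Nat.le_of_dvd (Int.natAbs_pos.2 hl0) this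
      simp at this
      omega

/-! ### Deletion and existence of the characteristic quasi-polynomial -/

theorem finite_quotient_mulSublattice {L : Type*} [AddCommGroup L] [Module.Finite ℤ L] {q : ℕ}
    (hq : 0 < q) : Finite (L ⧸ mulSublattice L q) := by
  refine Module.finite_of_fg_torsion _ fun y => ?_
  refine ⟨⟨(q : ℤ), mem_nonZeroDivisors_of_ne_zero (by exact_mod_cast hq.ne')⟩, ?_⟩
  obtain ⟨x, rfl⟩ := Submodule.Quotient.mk_surjective _ y
  change (q : ℤ) • (Submodule.Quotient.mk x : L ⧸ mulSublattice L q) = 0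
  rw [← Submodule.Quotient.mk_smul, Submodule.Quotient.mk_eq_zero]
  exact mem_mulSublattice.2 ⟨x, rfl⟩

theorem mk_eq_mk_iff {L : Type*} [AddCommGroup L] {q : ℕ} {x x' : L} :
    (Submodule.Quotient.mk x : L ⧸ mulSublattice L q) = Submodule.Quotient.mk x' ↔
      ∃ t, x = x' + (q : ℤ) • t := by
  rw [Submodule.Quotient.eq, mem_mulSublattice]
  simp only [sub_eq_iff_eq_add']

theorem modEq_add_smul_iff {L : Type*} [AddCommGroup L] {q : ℕ} (x t : L)
    (p : Module.Dual ℤ L × ℤ) :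
    p.1 (x + (q : ℤ) • t) ≡ p.2 [ZMOD (q : ℤ)] ↔ p.1 x ≡ p.2 [ZMOD (q : ℤ)] := by
  simp only [Int.ModEq, map_add, map_smul, smul_eq_mul, Int.add_mul_emod_self_left]

/-- Deletion: the number of points that avoid the hyperplanes in `A` and lie on those in `B` is
eventually a polynomial depending on a gcd. -/
theorem exists_card_avoiding_solutions {L : Type*} [AddCommGroup L] [Module.Free ℤ L]
    [Module.Finite ℤ L] (A : Finset (Module.Dual ℤ L × ℤ)) :
    ∀ B : Finset (Module.Dual ℤ L × ℤ), ∃ f : ℤ → ℤ, IsGcdPolynomial f ∧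
      ∃ q₀ : ℕ, ∀ q : ℕ, q₀ < q →
        (({y : L ⧸ mulSublattice L q | ∃ x, Submodule.Quotient.mk x = y ∧
          (∀ p ∈ A, ¬ p.1 x ≡ p.2 [ZMOD (q : ℤ)]) ∧
          ∀ p ∈ B, p.1 x ≡ p.2 [ZMOD (q : ℤ)]}.ncard : ℕ) : ℤ) = f q := by
  classical
  induction A using Finset.induction_on with
  | empty => simpa using exists_card_solutions
  | insert a A ha ih =>
    intro B
    obtain ⟨f, hf, q₀, h⟩ := ih B
    obtain ⟨f', hf', q₀', h'⟩ := ih (insert a B)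
    -- The points avoiding `A` and lying on `B` split into those off `a` and those on `a`; the
    -- latter are counted by `f'`.
    refine ⟨fun q => f q - f' q, hf.sub hf', max q₀ q₀', fun q hq => ?_⟩
    have := finite_quotient_mulSublattice (L := L) (q := q) (by omega)
    simp only
    rw [← h q (by omega), ← h' q (by omega), eq_sub_iff_add_eq, ← Nat.cast_add,
      ← Set.ncard_union_eq ?_ (Set.toFinite _) (Set.toFinite _)]
    · congr 2
      ext y
      simp only [Set.mem_union, Set.mem_ofPred_eq, Finset.mem_insert, forall_eq_or_imp]
      constructor
      · rintro (⟨x, hx, h1, h2⟩ | ⟨x, hx, h1, h2⟩)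
        · exact ⟨x, hx, h1.2, h2⟩
        · exact ⟨x, hx, h1, h2.2⟩
      · rintro ⟨x, hx, h1, h2⟩
        by_cases hxa : a.1 x ≡ a.2 [ZMOD (q : ℤ)]
        · exact Or.inr ⟨x, hx, h1, hxa, h2⟩
        · exact Or.inl ⟨x, hx, ⟨hxa, h1⟩, h2⟩
    · rw [Set.disjoint_left]
      rintro _ ⟨x, rfl, h1, -⟩ ⟨x', hx', -, h2⟩
      obtain ⟨t, rfl⟩ := mk_eq_mk_iff.1 hx'
      exact h1 a (Finset.mem_insert_self _ _)
        ((modEq_add_smul_iff x t a).1 (h2 a (Finset.mem_insert_self _ _)))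

/-- The characteristic quasi-polynomial of a finite arrangement exists. -/
theorem isCharQuasiPolynomial_charQuasiPolynomial {L : Type*} [AddCommGroup L] [Module.Free ℤ L]
    [Module.Finite ℤ L] {A : Set (Module.Dual ℤ L × ℤ)} (hA : A.Finite) :
    IsCharQuasiPolynomial A (charQuasiPolynomial A) := by
  obtain ⟨f, hf, q₀, h⟩ := exists_card_avoiding_solutions hA.toFinset ∅
  refine Classical.epsilon_spec (p := IsCharQuasiPolynomial A)
    ⟨f, hf.isQuasiPolynomialGcd, q₀, fun q hq => ?_⟩
  have := finite_quotient_mulSublattice (L := L) (q := q) (by omega)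
  refine ⟨Set.toFinite _, ?_⟩
  rw [← h q hq]
  simp [modComplement]

/-! ### Extending a shift identity to all integers; bijections of residue classes -/

theorem IsQuasiPolynomialGcd.exists_polynomial {f : ℤ → ℤ} (hf : IsQuasiPolynomialGcd f) :
    ∃ m : ℕ, 0 < m ∧ ∀ q : ℤ, ∃ g : Polynomial ℤ, ∀ t : ℤ, f (q + m * t) = g.eval (q + m * t) := by
  obtain ⟨m, hm, g, hg, -⟩ := hf
  refine ⟨m, hm, fun q => ?_⟩
  have hm0 : (0 : ℤ) < m := by exact_mod_cast hm
  have h1 := Int.emod_nonneg (q - 1) hm0.ne'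
  have h2 := Int.emod_lt_of_pos (q - 1) hm0
  refine ⟨g (((q - 1) % m).toNat + 1), fun t => hg _ (by rw [Finset.mem_Icc]; omega) _ ?_⟩
  push_cast
  rw [Int.toNat_of_nonneg h1]
  have h3 : q - 1 + m * t ≡ (q - 1) % m [ZMOD (m : ℤ)] := by
    simp [Int.ModEq]
  have := h3.add_right 1
  rwa [show q - 1 + m * t + 1 = q + m * t by ring] at this

/-- A shift relation between quasi-polynomials holds everywhere if it holds at all large
integers. -/
theorem IsQuasiPolynomialGcd.eq_shift {f f' : ℤ → ℤ} (hf : IsQuasiPolynomialGcd f)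
    (hf' : IsQuasiPolynomialGcd f') (c : ℤ) (q₀ : ℕ)
    (h : ∀ q : ℕ, q₀ < q → f' (q : ℤ) = f (q - c)) (q : ℤ) : f' q = f (q - c) := by
  obtain ⟨m, hm, hm'⟩ := hf.exists_polynomial
  obtain ⟨n, hn, hn'⟩ := hf'.exists_polynomial
  obtain ⟨g, hg⟩ := hm' (q - c)
  obtain ⟨g', hg'⟩ := hn' q
  have hmn : (0 : ℤ) < (m : ℤ) * n := by positivity
  have hpoly : g' = g.comp (Polynomial.X - Polynomial.C c) := by
    refine Polynomial.eq_of_infinite_eval_eq _ _ ?_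
    -- These points exceed `q₀` and are congruent to `q` modulo both `m` and `n`, so one polynomial
    -- governs each side on all of them.
    let F : ℕ → ℤ := fun t => q + ((m : ℤ) * n) * (q.natAbs + q₀ + 1 + t : ℕ)
    have hF : Function.Injective F := by
      intro a b hab
      have h3 : ((m : ℤ) * n) * (q.natAbs + q₀ + 1 + a : ℕ)
          = ((m : ℤ) * n) * (q.natAbs + q₀ + 1 + b : ℕ) := by
        simpa [F] using hab
      have h4 := mul_left_cancel₀ hmn.ne' h3
      omega
    refine (Set.infinite_range_of_injective hF).mono ?_
    rintro _ ⟨t, rfl⟩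
    have hbig : (q₀ : ℤ) < F t := by
      have h5 : ((q.natAbs + q₀ + 1 + t : ℕ) : ℤ)
          ≤ ((m : ℤ) * n) * (q.natAbs + q₀ + 1 + t : ℕ) :=
        le_mul_of_one_le_left (by positivity) hmn
      simp only [F]
      omega
    have h8 := h (F t).toNat (by omega)
    rw [Int.toNat_of_nonneg (by omega)] at h8
    have h6 := hg' (m * (q.natAbs + q₀ + 1 + t : ℕ))
    have h7 := hg (n * (q.natAbs + q₀ + 1 + t : ℕ))
    rw [show q + (n : ℤ) * (m * (q.natAbs + q₀ + 1 + t : ℕ)) = F t by simp only [F]; ring] at h6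
    rw [show q - c + (m : ℤ) * (n * (q.natAbs + q₀ + 1 + t : ℕ)) = F t - c by
      simp only [F]; ring] at h7
    change g'.eval (F t) = (g.comp _).eval (F t)
    rw [← h6, h8, h7]
    simp
  have h6 := hg' 0
  have h7 := hg 0
  simp only [mul_zero, add_zero] at h6 h7
  rw [h6, h7, hpoly]
  simp

/-- Counting classes: maps between lattices' representatives that are compatible with the
translations and inverse to each other give an equality of cardinalities. -/
theorem ncard_mk_image_eq_of_inverse {L : Type*} [AddCommGroup L] {q q' : ℕ} {p p' : L → Prop}
    (F G : L → L) (hF : ∀ x t, F (x + (q : ℤ) • t) = F x + (q' : ℤ) • t)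
    (hG : ∀ x t, G (x + (q' : ℤ) • t) = G x + (q : ℤ) • t)
    (hFG : ∀ x, p x → p' (F x) ∧ G (F x) = x) (hGF : ∀ x, p' x → p (G x) ∧ F (G x) = x) :
    {y : L ⧸ mulSublattice L q | ∃ x, Submodule.Quotient.mk x = y ∧ p x}.ncard =
      {y : L ⧸ mulSublattice L q' | ∃ x, Submodule.Quotient.mk x = y ∧ p' x}.ncard := by
  have aux : ∀ (q q' : ℕ) (F : L → L), (∀ x t, F (x + (q : ℤ) • t) = F x + (q' : ℤ) • t) →
      ∃ F' : L ⧸ mulSublattice L q → L ⧸ mulSublattice L q',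
        ∀ x, F' (Submodule.Quotient.mk x) = Submodule.Quotient.mk (F x) := by
    intro q q' F hF
    refine ⟨Quotient.lift (fun x => (Submodule.Quotient.mk (F x) : L ⧸ mulSublattice L q')) ?_,
      fun x => rfl⟩
    intro x x' hx
    obtain ⟨t, rfl⟩ := mk_eq_mk_iff.1 (Quotient.sound hx :
      (Submodule.Quotient.mk x : L ⧸ mulSublattice L q) = Submodule.Quotient.mk x')
    exact mk_eq_mk_iff.2 ⟨t, hF _ _⟩
  obtain ⟨F', hF'⟩ := aux q q' F hF
  obtain ⟨G', hG'⟩ := aux q' q G hG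
  have hinv : Set.InvOn G' F'
      {y : L ⧸ mulSublattice L q | ∃ x, Submodule.Quotient.mk x = y ∧ p x}
      {y : L ⧸ mulSublattice L q' | ∃ x, Submodule.Quotient.mk x = y ∧ p' x} := by
    constructor
    · rintro _ ⟨x, rfl, hx⟩
      rw [hF', hG', (hFG x hx).2]
    · rintro _ ⟨x, rfl, hx⟩
      rw [hG', hF', (hGF x hx).2]
  refine (hinv.bijOn ?_ ?_).ncard_eq
  · rintro _ ⟨x, rfl, hx⟩
    exact ⟨F x, (hF' x).symm, (hFG x hx).1⟩
  · rintro _ ⟨x, rfl, hx⟩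
    exact ⟨G x, (hG' x).symm, (hGF x hx).1⟩

/-! ### Roots, fundamental coweights and heights on the coweight lattice -/

section RootFunctional

variable {ι M N : Type*} [AddCommGroup M] [Module ℝ M] [AddCommGroup N] [Module ℝ N]
  {P : RootPairing ι ℝ M N} (b : P.Base)

theorem rootFunctional_eq_sum_of_root_eq_sum {i : ι} {s : Finset ι} {f : ι → ℤ}
    (h : P.root i = ∑ j ∈ s, f j • P.root j) (x : coweightLattice b) :
    rootFunctional b i x = ∑ j ∈ s, f j * rootFunctional b j x := by
  have : (rootFunctional b i x : ℝ) = ((∑ j ∈ s, f j * rootFunctional b j x : ℤ) : ℝ) := by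
    push_cast
    simp only [coe_rootFunctional_apply, RootPairing.root', h, map_sum, LinearMap.sum_apply,
      map_zsmul, LinearMap.smul_apply, zsmul_eq_mul]
  exact_mod_cast this

theorem rootFunctional_eq_add {i j k : ι} (h : P.root k = P.root i + P.root j)
    (x : coweightLattice b) :
    rootFunctional b k x = rootFunctional b i x + rootFunctional b j x := by
  have : (rootFunctional b k x : ℝ) = ((rootFunctional b i x + rootFunctional b j x : ℤ) : ℝ) := by
    push_cast
    simp only [coe_rootFunctional_apply, RootPairing.root', h, map_add, LinearMap.add_apply]
  exact_mod_cast this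

theorem rootFunctional_reflectionPerm_self (i : ι) (x : coweightLattice b) :
    rootFunctional b (P.reflectionPerm i i) x = -rootFunctional b i x := by
  have : (rootFunctional b (P.reflectionPerm i i) x : ℝ) = ((-rootFunctional b i x : ℤ) : ℝ) := by
    push_cast
    simp only [coe_rootFunctional_apply, RootPairing.root', P.root_reflectionPerm,
      P.reflection_apply_self, map_neg, LinearMap.neg_apply]
  exact_mod_cast this

theorem coweightLattice_ext [P.IsRootSystem] {x y : coweightLattice b}
    (h : ∀ j : b.support, rootFunctional b j x = rootFunctional b j y) : x = y := by
  refine Subtype.ext ((LinearMap.IsPerfPair.bijective_right P.toLinearMap).injective ?_)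
  refine b.toWeightBasis.ext fun j => ?_
  rw [b.toWeightBasis_apply]
  change P.root' j (x : N) = P.root' j (y : N)
  rw [← coe_rootFunctional_apply, ← coe_rootFunctional_apply, h]

/-- The fundamental coweights, dual to the simple roots. -/
noncomputable def fundamentalCoweight [P.IsRootSystem] (j : b.support) : coweightLattice b :=
  ⟨P.toLinearMap.flip.toPerfPair.symm (b.toWeightBasis.coord j), fun i hi => by
    classical
    refine ⟨if (⟨i, hi⟩ : b.support) = j then 1 else 0, ?_⟩
    rw [RootPairing.root', LinearMap.apply_toPerfPair_flip, Module.Basis.coord_apply]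
    have := b.toWeightBasis_repr_root ⟨i, hi⟩
    simp only at this
    rw [this, Finsupp.single_apply]
    split_ifs <;> simp⟩

open Classical in
theorem rootFunctional_fundamentalCoweight [P.IsRootSystem] (i j : b.support) :
    rootFunctional b i (fundamentalCoweight b j) = if i = j then 1 else 0 := by
  have : (rootFunctional b i (fundamentalCoweight b j) : ℝ) = if i = j then 1 else 0 := by
    rw [coe_rootFunctional_apply, fundamentalCoweight, RootPairing.root',
      LinearMap.apply_toPerfPair_flip, Module.Basis.coord_apply, b.toWeightBasis_repr_root,
      Finsupp.single_apply]
  exact_mod_cast this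

/-- The sum of the fundamental coweights. -/
noncomputable def weylCoweight [P.IsRootSystem] : coweightLattice b :=
  ∑ j, fundamentalCoweight b j

theorem rootFunctional_weylCoweight_of_mem [P.IsRootSystem] (i : b.support) :
    rootFunctional b i (weylCoweight b) = 1 := by
  classical
  rw [weylCoweight, map_sum]
  simp [rootFunctional_fundamentalCoweight]

/-- The coefficient of the simple root `j` in the root `i`. -/
noncomputable def rootCoef [P.IsRootSystem] (i : ι) (j : b.support) : ℤ :=
  rootFunctional b i (fundamentalCoweight b j)

theorem rootCoef_eq_add [P.IsRootSystem] {i j k : ι} (h : P.root k = P.root i + P.root j) (l : b.support) :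
    rootCoef b k l = rootCoef b i l + rootCoef b j l :=
  rootFunctional_eq_add b h _

theorem rootFunctional_eq_sum [P.IsRootSystem] (i : ι) (x : coweightLattice b) :
    rootFunctional b i x = ∑ j, rootCoef b i j * rootFunctional b j x := by
  classical
  have h : x = ∑ j : b.support, rootFunctional b j x • fundamentalCoweight b j := by
    refine coweightLattice_ext b fun i => ?_
    rw [map_sum]
    simp [rootFunctional_fundamentalCoweight]
  refine ((congrArg _ h).trans (map_sum _ _ _)).trans ?_
  refine Finset.sum_congr rfl fun j _ => ?_
  rw [map_smul, smul_eq_mul, mul_comm, rootCoef]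

/-- Both sides are additive in the root and equal 1 on simple roots. Heights thereby become values
at the lattice point `weylCoweight b`, which can be moved by symmetries. -/
theorem height_eq_rootFunctional [P.IsRootSystem] (i : ι) :
    b.height i = rootFunctional b i (weylCoweight b) := by
  obtain ⟨f, -, -, hf⟩ := b.exists_root_eq_sum_int i
  rw [RootPairing.Base.height_eq_sum hf, rootFunctional_eq_sum_of_root_eq_sum b hf]
  refine Finset.sum_congr rfl fun j hj => ?_
  rw [rootFunctional_weylCoweight_of_mem b ⟨j, hj⟩, mul_one]

theorem height_eq_sum_rootCoef [P.IsRootSystem] (i : ι) :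
    b.height i = ∑ j, rootCoef b i j := by
  rw [height_eq_rootFunctional, weylCoweight, map_sum]
  rfl

theorem rootCoef_nonneg_or_nonpos [P.IsRootSystem] (i : ι) :
    (∀ j, 0 ≤ rootCoef b i j) ∨ ∀ j, rootCoef b i j ≤ 0 := by
  classical
  obtain ⟨f, -, hs, hf⟩ := b.exists_root_eq_sum_int i
  have h : ∀ j : b.support, rootCoef b i j = f j := by
    intro j
    rw [rootCoef, rootFunctional_eq_sum_of_root_eq_sum b hf, Finset.sum_eq_single_of_mem (j : ι) j.2]
    · simp [rootFunctional_fundamentalCoweight]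
    · intro k hk hkj
      have := rootFunctional_fundamentalCoweight b ⟨k, hk⟩ j
      rw [if_neg (fun h => hkj (congrArg Subtype.val h))] at this
      rw [this, mul_zero]
  rcases hs with hs | hs
  · exact Or.inl fun j => (h j).symm ▸ hs.le j
  · exact Or.inr fun j => (h j).symm ▸ hs.le j

theorem rootCoef_nonneg [P.IsRootSystem] {i : ι} (hi : b.IsPos i) (j : b.support) :
    0 ≤ rootCoef b i j := by
  rcases rootCoef_nonneg_or_nonpos b i with h | h
  · exact h j
  · have := Finset.sum_nonpos fun j (_ : j ∈ Finset.univ) => h j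
    rw [← height_eq_sum_rootCoef] at this
    exact absurd hi this.not_gt

theorem rootCoef_nonpos [P.IsRootSystem] {i : ι} (hi : ¬ b.IsPos i) (j : b.support) :
    rootCoef b i j ≤ 0 := by
  rcases rootCoef_nonneg_or_nonpos b i with h | h
  · have := Finset.sum_nonneg fun j (_ : j ∈ Finset.univ) => h j
    rw [← height_eq_sum_rootCoef, ← RootPairing.Base.isPos_iff'] at this
    exact absurd this hi
  · exact h j

theorem isPos_reflectionPerm_self (i : ι) : b.IsPos (P.reflectionPerm i i) ↔ ¬ b.IsPos i :=
  RootPairing.Base.IsPos.neg_iff_not b i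

theorem coweightLattice_free_finite [P.IsRootSystem] :
    Module.Free ℤ (coweightLattice b) ∧ Module.Finite ℤ (coweightLattice b) := by
  classical
  let Ψ : coweightLattice b →ₗ[ℤ] (b.support → ℤ) := LinearMap.pi fun j => rootFunctional b j
  have hΨ : Function.Bijective Ψ := by
    constructor
    · intro x y h
      exact coweightLattice_ext b fun j => congrFun h j
    · intro v
      refine ⟨∑ j, v j • fundamentalCoweight b j, funext fun i => ?_⟩
      change rootFunctional b i _ = _
      rw [map_sum]
      simp [rootFunctional_fundamentalCoweight]
  let e := LinearEquiv.ofBijective Ψ hΨ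
  exact ⟨Module.Free.of_equiv e.symm, Module.Finite.equiv e.symm⟩

theorem truncatedAffineArrangement_finite [Finite ι] (lo hi : ℤ) :
    (truncatedAffineArrangement b lo hi).Finite := by
  refine ((Set.finite_univ (α := ι)).prod (Set.finite_Icc lo hi)).image
    (fun p : ι × ℤ => (rootFunctional b p.1, p.2)) |>.subset ?_
  rintro _ ⟨i, -, k, h1, h2, rfl⟩
  exact ⟨(i, k), ⟨Set.mem_univ _, h1, h2⟩, rfl⟩

/-- The coroots lie in the coweight lattice. -/
noncomputable def latticeCoroot [P.IsCrystallographic] (i : ι) : coweightLattice b :=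
  ⟨P.coroot i, fun j _ => ⟨P.pairingIn ℤ j i, by
    rw [P.root'_coroot_eq_pairing, ← P.algebraMap_pairingIn ℤ]; rfl⟩⟩

theorem rootFunctional_latticeCoroot [P.IsCrystallographic] (i j : ι) :
    rootFunctional b j (latticeCoroot b i) = P.pairingIn ℤ j i := by
  have : (rootFunctional b j (latticeCoroot b i) : ℝ) = (P.pairingIn ℤ j i : ℝ) := by
    rw [coe_rootFunctional_apply, latticeCoroot, P.root'_coroot_eq_pairing,
      ← P.algebraMap_pairingIn ℤ]
    rfl
  exact_mod_cast this

theorem pairingIn_eq_sum [P.IsRootSystem] [P.IsCrystallographic] (i k : ι) :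
    P.pairingIn ℤ i k = ∑ j : b.support, rootCoef b i j * P.pairingIn ℤ j k := by
  simp only [← rootFunctional_latticeCoroot b, ← rootFunctional_eq_sum]

/-- The reflection in the `i`-th root as a map of the coweight lattice. -/
noncomputable def latticeReflection [P.IsCrystallographic] (i : ι) :
    coweightLattice b →+ coweightLattice b where
  toFun x := x - rootFunctional b i x • latticeCoroot b i
  map_zero' := by simp
  map_add' x y := by rw [map_add, add_smul]; abel

theorem latticeReflection_apply [P.IsCrystallographic] (i : ι) (x : coweightLattice b) :
    latticeReflection b i x = x - rootFunctional b i x • latticeCoroot b i := rfl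

theorem rootFunctional_latticeReflection [P.IsCrystallographic] (i j : ι)
    (x : coweightLattice b) :
    rootFunctional b (P.reflectionPerm i j) (latticeReflection b i x) = rootFunctional b j x := by
  have : (rootFunctional b (P.reflectionPerm i j) (latticeReflection b i x) : ℝ) =
      rootFunctional b j x := by
    rw [coe_rootFunctional_apply, coe_rootFunctional_apply, latticeReflection_apply,
      RootPairing.root', P.root_reflectionPerm, Submodule.coe_sub, Submodule.coe_smul, latticeCoroot,
      map_sub, map_zsmul, zsmul_eq_mul, coe_rootFunctional_apply, P.reflection_apply]
    simp only [RootPairing.root', RootPairing.coroot', map_sub, map_smul, LinearMap.sub_apply,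
      LinearMap.smul_apply, smul_eq_mul, LinearMap.flip_apply, P.root_coroot_two]
    ring
  exact_mod_cast this

theorem latticeReflection_latticeReflection [P.IsCrystallographic] (i : ι)
    (x : coweightLattice b) : latticeReflection b i (latticeReflection b i x) = x := by
  have h : rootFunctional b i (latticeReflection b i x) = -rootFunctional b i x := by
    rw [latticeReflection_apply, map_sub, map_smul, rootFunctional_latticeCoroot,
      P.pairingIn_same, smul_eq_mul]
    ring
  rw [latticeReflection_apply, h, latticeReflection_apply, neg_smul]
  abel

end RootFunctional

/-! ### The highest root -/

section HighestRoot

variable {ι M N : Type*} [Finite ι] [AddCommGroup M] [Module ℝ M] [AddCommGroup N] [Module ℝ N]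
  {P : RootPairing ι ℝ M N} [P.IsCrystallographic] (b : P.Base)

/-- A negative pairing would make the sum a root, unless the two roots are opposite, which
positivity excludes. -/
theorem pairingIn_nonneg_of_add_notMem {i : ι} (hi : b.IsPos i)
    (hadd : ∀ j ∈ b.support, P.root i + P.root j ∉ Set.range P.root) (j : b.support) :
    0 ≤ P.pairingIn ℤ i j := by
  by_contra! h
  refine hadd j j.2 (P.root_add_root_mem_of_pairingIn_neg h fun h' => ?_)
  have h2 : P.root i = P.root (P.reflectionPerm j j) := by
    rw [h', P.root_reflectionPerm, P.reflection_apply_self]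
  rw [P.root.injective h2, isPos_reflectionPerm_self] at hi
  exact hi (RootPairing.Base.isPos_of_mem_support j.2)

/-- A positive root to which no simple root can be added involves all simple roots. -/
theorem one_le_rootCoef_of_add_notMem [P.IsRootSystem] [P.IsReduced] [P.IsIrreducible] {i : ι} (hi : b.IsPos i)
    (hadd : ∀ j ∈ b.support, P.root i + P.root j ∉ Set.range P.root) (j : b.support) :
    1 ≤ rootCoef b i j := by
  by_contra! hj
  have hj0 : rootCoef b i j = 0 := le_antisymm (by omega) (rootCoef_nonneg b hi j)
  have hall : ∀ k, rootCoef b i k = 0 := by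
    intro k
    refine b.induction_on_cartanMatrix (fun k => rootCoef b i k = 0) hj0 ?_
    -- Zero coefficients spread along the Dynkin diagram: with coefficient 0 at `k`, the pairing
    -- with the coroot of `k` is a sum of nonpositive terms but is itself nonnegative, so every
    -- neighbour `l` of `k` has coefficient 0 too.
    intro k l hk hkl
    have h0 := pairingIn_nonneg_of_add_notMem b hi hadd k
    rw [pairingIn_eq_sum b] at h0
    have hle : ∀ m ∈ Finset.univ, rootCoef b i m * P.pairingIn ℤ m k ≤ 0 := by
      intro m _
      rcases eq_or_ne m k with rfl | hmk
      · rw [hk, zero_mul]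
      · exact mul_nonpos_of_nonneg_of_nonpos (rootCoef_nonneg b hi m)
          (b.pairingIn_le_zero_of_ne (fun h => hmk (Subtype.ext h)) m.2 k.2)
    have h1 := (Finset.sum_eq_zero_iff_of_nonpos hle).1 (le_antisymm (Finset.sum_nonpos hle) h0) l
      (Finset.mem_univ l)
    exact (mul_eq_zero.1 h1).resolve_right hkl
  have : b.height i = 0 := by simp [height_eq_sum_rootCoef, hall]
  exact b.height_ne_zero i this

/-- The root `θ` is the highest root. -/
structure IsHighestRoot {P : RootPairing ι ℝ M N} [P.IsRootSystem] (b : P.Base) (θ : ι) : Prop where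
  height_le : ∀ i, b.height i ≤ b.height θ
  one_le_rootCoef : ∀ j, 1 ≤ rootCoef b θ j
  rootCoef_le : ∀ i j, rootCoef b i j ≤ rootCoef b θ j

/-- Existence of the highest root. -/
theorem exists_highestRoot [P.IsRootSystem] [P.IsReduced] [P.IsIrreducible] :
    ∃ θ : ι, IsHighestRoot b θ := by
  have : Nonempty ι := by
    by_contra h
    rw [not_nonempty_iff] at h
    have := RootPairing.IsIrreducible.nontrivial P
    have h1 := RootPairing.IsRootSystem.span_root_eq_top (P := P)
    rw [Set.range_eq_empty, Submodule.span_empty] at h1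
    exact bot_ne_top h1
  obtain ⟨θ, hθ⟩ := Finite.exists_max b.height
  have hθpos : b.IsPos θ := by
    rcases RootPairing.Base.IsPos.or_neg b θ with h | h
    · exact h
    · exact lt_of_lt_of_le h (hθ _)
  have hθadd : ∀ j ∈ b.support, P.root θ + P.root j ∉ Set.range P.root := by
    rintro j hj ⟨k, hk⟩
    have h1 := b.height_add hk
    have h2 := hθ k
    rw [RootPairing.Base.height_one_of_mem_support hj] at h1
    omega
  have hθ1 := one_le_rootCoef_of_add_notMem b hθpos hθadd
  refine ⟨θ, hθ, hθ1, fun i j => ?_⟩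
  by_cases hi : b.IsPos i
  swap
  · exact (rootCoef_nonpos b hi j).trans (by linarith [hθ1 j])
  -- Climb from `i` to a root `η` of maximal height among those dominating it coefficientwise. Then
  -- `η` is dominant, and it remains to compare `η` with `θ`.
  obtain ⟨η, hη, hmax⟩ := Set.exists_max_image {k | ∀ l, rootCoef b i l ≤ rootCoef b k l} b.height
    (Set.toFinite _) ⟨i, fun l => le_rfl⟩
  have hηpos : b.IsPos η := by
    refine lt_of_lt_of_le hi ?_
    rw [height_eq_sum_rootCoef, height_eq_sum_rootCoef]
    exact Finset.sum_le_sum fun l _ => hη l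
  have hηadd : ∀ j ∈ b.support, P.root η + P.root j ∉ Set.range P.root := by
    rintro j hj ⟨k, hk⟩
    have h1 := b.height_add hk
    rw [RootPairing.Base.height_one_of_mem_support hj] at h1
    have h2 := hmax k fun l => by
      rw [rootCoef_eq_add b hk]
      have := rootCoef_nonneg b (RootPairing.Base.isPos_of_mem_support hj) l
      linarith [hη l]
    omega
  have hη0 : ∀ j : b.support, 0 ≤ P.pairingIn ℤ j η := by
    intro j
    have := pairingIn_nonneg_of_add_notMem b hηpos hηadd j
    by_contra! h
    rw [P.pairingIn_lt_zero_iff] at h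
    omega
  -- Since `θ` involves all simple roots and each pairs nonnegatively with `η`, a vanishing total
  -- would force `η` to pair to zero with its own coroot. Positivity makes `θ - η` zero or a root.
  have hpos : 0 < P.pairingIn ℤ θ η := by
    by_contra! h
    rw [pairingIn_eq_sum b] at h
    have hge : ∀ m ∈ Finset.univ, 0 ≤ rootCoef b θ m * P.pairingIn ℤ m η :=
      fun m _ => mul_nonneg (by linarith [hθ1 m]) (hη0 m)
    have h1 := (Finset.sum_eq_zero_iff_of_nonneg hge).1 (le_antisymm h (Finset.sum_nonneg hge))
    have h2 : P.pairingIn ℤ η η = 0 := by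
      rw [pairingIn_eq_sum b]
      refine Finset.sum_eq_zero fun m hm => ?_
      rw [(mul_eq_zero.1 (h1 m hm)).resolve_left (by linarith [hθ1 m]), mul_zero]
    simp at h2
  refine (hη j).trans ?_
  rcases eq_or_ne θ η with rfl | hne
  · exact le_rfl
  obtain ⟨k, hk⟩ := P.root_sub_root_mem_of_pairingIn_pos hpos hne
  have hk' : P.root θ = P.root k + P.root η := by rw [hk, sub_add_cancel]
  have hkpos : b.IsPos k := by
    by_contra hkn
    have h1 := b.height_add hk'
    have h2 : b.height k < 0 := by
      rw [RootPairing.Base.isPos_iff'] at hkn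
      omega
    have := hθ η
    omega
  rw [rootCoef_eq_add b hk']
  linarith [rootCoef_nonneg b hkpos j]

end HighestRoot

/-! ### Moving a point into the open alcove -/

section Alcove

variable {ι M N : Type*} [AddCommGroup M] [Module ℝ M] [AddCommGroup N] [Module ℝ N]
  {P : RootPairing ι ℝ M N}

/-- An automorphism of the coweight lattice that permutes the roots. -/
structure LatticeSymmetry (b : P.Base) where
  /-- the permutation of the roots -/
  perm : ι → ι
  /-- the automorphism -/
  map : coweightLattice b ≃+ coweightLattice b
  perm_surjective : Function.Surjective perm
  rootFunctional_perm : ∀ i x, rootFunctional b (perm i) (map x) = rootFunctional b i x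

/-- The composition of a symmetry with the reflection in the `i`-th root. -/
noncomputable def LatticeSymmetry.compReflection [P.IsCrystallographic] {b : P.Base}
    (w : LatticeSymmetry b) (i : ι) : LatticeSymmetry b where
  perm := w.perm ∘ P.reflectionPerm i
  map := AddEquiv.trans
    { latticeReflection b i with
      invFun := latticeReflection b i
      left_inv := latticeReflection_latticeReflection b i
      right_inv := latticeReflection_latticeReflection b i } w.map
  perm_surjective := w.perm_surjective.comp (P.reflectionPerm i).surjective
  rootFunctional_perm j x :=
    (w.rootFunctional_perm _ _).trans (rootFunctional_latticeReflection b i j x)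

theorem LatticeSymmetry.compReflection_map [P.IsCrystallographic] {b : P.Base}
    (w : LatticeSymmetry b) (i : ι) (x : coweightLattice b) :
    (w.compReflection i).map x = w.map (latticeReflection b i x) := rfl

theorem LatticeSymmetry.rootFunctional_map_symm {b : P.Base} (w : LatticeSymmetry b) (i : ι)
    (x : coweightLattice b) :
    rootFunctional b i (w.map.symm x) = rootFunctional b (w.perm i) x := by
  rw [← w.rootFunctional_perm, AddEquiv.apply_symm_apply]

variable (b : P.Base)

/-- Reindexing by the reflection in the root `i` shows its invariance for the form given by summing
over all roots. -/
theorem two_mul_sum_rootFunctional_mul_latticeCoroot [Fintype ι] [P.IsCrystallographic] (i : ι)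
    (x : coweightLattice b) :
    2 * ∑ j, rootFunctional b j x * rootFunctional b j (latticeCoroot b i) =
      rootFunctional b i x * ∑ j, rootFunctional b j (latticeCoroot b i) ^ 2 := by
  have h1 : ∀ j, rootFunctional b (P.reflectionPerm i j) x =
      rootFunctional b j x -
        rootFunctional b i x * rootFunctional b j (latticeCoroot b i) := by
    intro j
    rw [← latticeReflection_latticeReflection b i x, rootFunctional_latticeReflection,
      latticeReflection_latticeReflection, latticeReflection_apply, map_sub, map_smul, smul_eq_mul]
  have h2 : ∀ j, rootFunctional b (P.reflectionPerm i j) (latticeCoroot b i) =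
      -rootFunctional b j (latticeCoroot b i) := by
    intro j
    rw [rootFunctional_latticeCoroot, rootFunctional_latticeCoroot,
      ← P.pairingIn_reflectionPerm, P.pairingIn_reflectionPerm_self_right]
  have h3 := (P.reflectionPerm i).sum_comp
    fun j => rootFunctional b j x * rootFunctional b j (latticeCoroot b i)
  simp only [h1, h2] at h3
  have h4 : ∑ j, (rootFunctional b j x -
      rootFunctional b i x * rootFunctional b j (latticeCoroot b i)) *
        -rootFunctional b j (latticeCoroot b i) =
      rootFunctional b i x * ∑ j, rootFunctional b j (latticeCoroot b i) ^ 2 -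
        ∑ j, rootFunctional b j x * rootFunctional b j (latticeCoroot b i) := by
    rw [Finset.mul_sum, ← Finset.sum_sub_distrib]
    exact Finset.sum_congr rfl fun j _ => by ring
  linarith

theorem sum_sq_rootFunctional_sub_smul_latticeCoroot [Fintype ι] [P.IsCrystallographic] (i : ι)
    (x : coweightLattice b) (a : ℤ) :
    ∑ j, rootFunctional b j (x - a • latticeCoroot b i) ^ 2 =
      ∑ j, rootFunctional b j x ^ 2 +
        a * (a - rootFunctional b i x) * ∑ j, rootFunctional b j (latticeCoroot b i) ^ 2 := by
  have h1 : ∑ j, rootFunctional b j (x - a • latticeCoroot b i) ^ 2 =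
      ∑ j, rootFunctional b j x ^ 2 -
        a * (2 * ∑ j, rootFunctional b j x * rootFunctional b j (latticeCoroot b i)) +
        a ^ 2 * ∑ j, rootFunctional b j (latticeCoroot b i) ^ 2 := by
    simp only [Finset.mul_sum]
    rw [← Finset.sum_sub_distrib, ← Finset.sum_add_distrib]
    refine Finset.sum_congr rfl fun j _ => ?_
    rw [map_sub, map_smul, smul_eq_mul]
    ring
  rw [h1, two_mul_sum_rootFunctional_mul_latticeCoroot]
  ring

theorem sum_sq_latticeCoroot_pos [Fintype ι] [P.IsCrystallographic] (i : ι) :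
    0 < ∑ j, rootFunctional b j (latticeCoroot b i) ^ 2 := by
  refine Finset.sum_pos' (fun j _ => sq_nonneg _) ⟨i, Finset.mem_univ i, ?_⟩
  rw [rootFunctional_latticeCoroot, P.pairingIn_same]
  norm_num

/-- Every point off the walls is carried into the open fundamental alcove by a symmetry and a
translation: take the point of its orbit that is closest to an interior point of the alcove. -/
theorem exists_mem_open_alcove [Finite ι] [P.IsCrystallographic] [P.IsRootSystem] (θ : ι)
    (hθ : 0 < b.height θ) {Q : ℤ} (hQ : 0 < Q) (x : coweightLattice b)
    (hx : ∀ i, ¬ Q ∣ rootFunctional b i x) :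
    ∃ (w : LatticeSymmetry b) (t y : coweightLattice b), x = w.map y + Q • t ∧
      (∀ j : b.support, 0 < rootFunctional b j y) ∧ rootFunctional b θ y < Q := by
  cases nonempty_fintype ι
  set h := 1 + b.height θ with hh
  have hh0 : 0 < h := by omega
  -- Up to the factor `h ^ 2`, this is the squared distance from `y` to the interior point `Q ρ / h`
  -- of the alcove, with denominators cleared so that its values are integers.
  let E : coweightLattice b → ℤ := fun y => ∑ j, rootFunctional b j (h • y - Q • weylCoweight b) ^ 2
  have hE0 : ∀ y, 0 ≤ E y := fun y => Finset.sum_nonneg fun j _ => sq_nonneg _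
  let S : Set (coweightLattice b) :=
    {y | ∃ (w : LatticeSymmetry b) (t : coweightLattice b), x = w.map y + Q • t}
  have hS : S.Nonempty :=
    ⟨x, ⟨id, AddEquiv.refl _, Function.surjective_id, fun _ _ => rfl⟩, 0, by simp⟩
  obtain ⟨y, ⟨w, t, hxy⟩, hmin⟩ := (measure fun y => (E y).toNat).wf.has_min S hS
  have hne : ∀ i, ¬ Q ∣ rootFunctional b i y := by
    intro i hi
    refine hx (w.perm i) ?_
    rw [hxy, map_add, w.rootFunctional_perm, map_smul]
    exact dvd_add hi (Dvd.intro _ rfl)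
  -- Minimality puts `y` and the reference point weakly on the same side of every wall `α_i = c Q`:
  -- otherwise the reflection `y'` of `y` in that wall would be closer.
  have key : ∀ i c, 0 ≤ (rootFunctional b i y - c * Q) * (b.height i - h * c) := by
    intro i c
    let y' := y - (rootFunctional b i y - c * Q) • latticeCoroot b i
    have hy' : y' ∈ S := by
      refine ⟨w.compReflection i, t + c • w.map (latticeCoroot b i), ?_⟩
      have h1 : latticeReflection b i y' = y - (c * Q) • latticeCoroot b i := by
        have h2 : y' = latticeReflection b i y + (c * Q) • latticeCoroot b i := by
          rw [latticeReflection_apply]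
          simp only [y']
          module
        rw [h2, map_add, latticeReflection_latticeReflection, map_zsmul]
        rw [latticeReflection_apply, rootFunctional_latticeCoroot, P.pairingIn_same]
        module
      rw [LatticeSymmetry.compReflection_map, h1, map_sub, map_zsmul, hxy]
      module
    have h1 : E y ≤ E y' := by
      have h2 := hE0 y
      have h3 := hE0 y'
      have h4 : ¬ (E y').toNat < (E y).toNat := hmin y' hy'
      omega
    have h2 : h • y' - Q • weylCoweight b = (h • y - Q • weylCoweight b) -
        (h * (rootFunctional b i y - c * Q)) • latticeCoroot b i := by
      simp only [y']
      module
    have h3 : E y' = E y + h * (rootFunctional b i y - c * Q) *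
        (h * (rootFunctional b i y - c * Q) -
          (h * rootFunctional b i y - Q * b.height i)) *
        ∑ j, rootFunctional b j (latticeCoroot b i) ^ 2 := by
      simp only [E]
      rw [h2, sum_sq_rootFunctional_sub_smul_latticeCoroot, map_sub, map_smul, map_smul,
        ← height_eq_rootFunctional, smul_eq_mul, smul_eq_mul]
    have h4 := sum_sq_latticeCoroot_pos b i
    have h5 : 0 ≤ (h * Q * ∑ j, rootFunctional b j (latticeCoroot b i) ^ 2) *
        ((rootFunctional b i y - c * Q) * (b.height i - h * c)) := by
      calc 0 ≤ E y' - E y := by linarith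
        _ = _ := by rw [h3]; ring
    exact nonneg_of_mul_nonneg_right h5 (by positivity)
  refine ⟨w, t, y, hxy, fun j => ?_, ?_⟩
  · have h1 := key j 0
    rw [RootPairing.Base.height_one_of_mem_support j.2] at h1
    have h2 : rootFunctional b j y ≠ 0 := fun h0 => hne j (h0 ▸ dvd_zero Q)
    have h3 : 0 ≤ rootFunctional b j y := by linarith
    omega
  · have h1 := key θ 1
    have h2 : rootFunctional b θ y ≠ Q := fun h0 => hne θ (h0 ▸ dvd_rfl)
    have h3 : b.height θ - h * 1 = -1 := by rw [hh]; ring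
    rw [h3] at h1
    omega

end Alcove

/-! ### The half-open alcove and its centre -/

section Alcove

variable {ι M N : Type*} [AddCommGroup M] [Module ℝ M] [AddCommGroup N] [Module ℝ N]
  {P : RootPairing ι ℝ M N}

/-- The integral inequalities that cut out of the `q`-th dilation of the closed fundamental alcove
the points at distance at least `k` from all walls, and at distance more than `k + c` from those
walls on the positive side of whose images under `w` the image of the alcove lies. -/
structure InAlcove {b : P.Base} (θ : ι) (w : LatticeSymmetry b) (q k c : ℤ)
    (y : coweightLattice b) : Prop where
  le_simple : ∀ j : b.support, k ≤ rootFunctional b j y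
  lt_simple : ∀ j : b.support, b.IsPos (w.perm j) → k + c + 1 ≤ rootFunctional b j y
  highest_le : rootFunctional b θ y ≤ q - k
  highest_lt : ¬ b.IsPos (w.perm θ) → rootFunctional b θ y ≤ q - k - c - 1

theorem InAlcove.mono {b : P.Base} {θ : ι} {w : LatticeSymmetry b} {q k c k' c' : ℤ}
    {y : coweightLattice b} (hy : InAlcove θ w q k c y) (hk : k' ≤ k) (hc : c' ≤ c) :
    InAlcove θ w q k' c' y where
  le_simple j := hk.trans (hy.le_simple j)
  lt_simple j hj := by linarith [hy.lt_simple j hj]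
  highest_le := by linarith [hy.highest_le]
  highest_lt h := by linarith [hy.highest_lt h]

theorem InAlcove.sum_nonneg {b : P.Base} {θ : ι} {w : LatticeSymmetry b} {q k c : ℤ}
    {y : coweightLattice b} (hy : InAlcove θ w q k c y) (hk : 0 ≤ k) {a : b.support → ℤ}
    (ha : ∀ j, 0 ≤ a j) : 0 ≤ ∑ l, a l * rootFunctional b l y :=
  Finset.sum_nonneg fun l _ => mul_nonneg (ha l) (hk.trans (hy.le_simple l))

/-- A nonnegative integral combination with a positive coefficient dominates each of its
terms with a positive coefficient. -/
theorem InAlcove.le_sum {b : P.Base} {θ : ι} {w : LatticeSymmetry b} {q k c : ℤ}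
    {y : coweightLattice b} (hy : InAlcove θ w q k c y) (hk : 0 ≤ k) {a : b.support → ℤ}
    (ha : ∀ j, 0 ≤ a j) {j : b.support} (hj : 1 ≤ a j) :
    rootFunctional b j y ≤ ∑ l, a l * rootFunctional b l y := by
  have h0 : ∀ l : b.support, 0 ≤ rootFunctional b l y := fun l => hk.trans (hy.le_simple l)
  refine le_trans ?_ (Finset.single_le_sum (fun l _ => mul_nonneg (ha l) (h0 l)) (Finset.mem_univ j))
  exact le_mul_of_one_le_left (h0 j) hj

variable [P.IsRootSystem] {b : P.Base} {θ : ι}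

theorem IsHighestRoot.isPos (hθ : IsHighestRoot b θ) : b.IsPos θ := by
  rcases RootPairing.Base.IsPos.or_neg b θ with h | h
  · exact h
  · exact lt_of_lt_of_le h (hθ.height_le _)

theorem IsHighestRoot.coxeterNumber_eq [Finite ι] (hθ : IsHighestRoot b θ) :
    coxeterNumber b = 1 + b.height θ := by
  rw [coxeterNumber]
  congr 1
  have : Nonempty ι := ⟨θ⟩
  exact le_antisymm (ciSup_le hθ.height_le) (le_ciSup (Set.finite_range _).bddAbove θ)

theorem IsHighestRoot.abs_height_le (hθ : IsHighestRoot b θ) (i : ι) :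
    |b.height i| ≤ b.height θ := by
  rw [abs_le]
  refine ⟨?_, hθ.height_le i⟩
  have := hθ.height_le (P.reflectionPerm i i)
  rw [height_eq_rootFunctional, rootFunctional_reflectionPerm_self,
    ← height_eq_rootFunctional] at this
  omega

/-- Used to transfer signs: when the left side is positive, some simple root with nonzero
coefficient contributes positively. -/
theorem LatticeSymmetry.height_perm (w : LatticeSymmetry b) (i : ι) :
    b.height (w.perm i) = ∑ j, rootCoef b i j * b.height (w.perm j) := by
  simp only [height_eq_rootFunctional, ← w.rootFunctional_map_symm]
  exact rootFunctional_eq_sum b i _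

theorem LatticeSymmetry.isPos_perm_reflectionPerm_self (w : LatticeSymmetry b) (i : ι) :
    b.IsPos (w.perm (P.reflectionPerm i i)) ↔ ¬ b.IsPos (w.perm i) := by
  have h : b.height (w.perm (P.reflectionPerm i i)) = -b.height (w.perm i) := by
    simp only [height_eq_rootFunctional, ← w.rootFunctional_map_symm,
      rootFunctional_reflectionPerm_self]
  have := b.height_ne_zero (w.perm i)
  rw [RootPairing.Base.isPos_iff, RootPairing.Base.isPos_iff, h]
  omega

section bounds

variable {w : LatticeSymmetry b} {q k c : ℤ} {y : coweightLattice b} {i : ι}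

theorem InAlcove.le_rootFunctional (hy : InAlcove θ w q k c y) (hk : 0 ≤ k) (hi : b.IsPos i) :
    k ≤ rootFunctional b i y := by
  obtain ⟨j, -, hj⟩ : ∃ j ∈ Finset.univ, 0 < rootCoef b i j := by
    refine Finset.exists_lt_of_sum_lt ?_
    rw [← height_eq_sum_rootCoef]
    simpa using show 0 < b.height i from hi
  rw [rootFunctional_eq_sum]
  exact (hy.le_simple j).trans (hy.le_sum hk (rootCoef_nonneg b hi) hj)

/-- As `w α_i` has positive height, some simple root `α_j` occurring in `α_i` has `w α_j` positive,
and its stronger bound passes to `α_i`. -/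
theorem InAlcove.lt_rootFunctional (hy : InAlcove θ w q k c y) (hk : 0 ≤ k) (hi : b.IsPos i)
    (hwi : b.IsPos (w.perm i)) : k + c + 1 ≤ rootFunctional b i y := by
  obtain ⟨j, -, hj⟩ : ∃ j ∈ Finset.univ, 0 < rootCoef b i j * b.height (w.perm j) := by
    refine Finset.exists_lt_of_sum_lt ?_
    rw [← w.height_perm]
    simpa using show 0 < b.height (w.perm i) from hwi
  have h1 := rootCoef_nonneg b hi j
  have h2 : 1 ≤ rootCoef b i j := by
    rcases h1.eq_or_lt with h | h
    · rw [← h, zero_mul] at hj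
      exact absurd hj (lt_irrefl _)
    · exact h
  have h3 : b.IsPos (w.perm j) := pos_of_mul_pos_right hj h1
  rw [rootFunctional_eq_sum]
  exact (hy.lt_simple j h3).trans (hy.le_sum hk (rootCoef_nonneg b hi) h2)

theorem rootFunctional_highest_sub (y : coweightLattice b) :
    rootFunctional b θ y - rootFunctional b i y =
      ∑ j, (rootCoef b θ j - rootCoef b i j) * rootFunctional b j y := by
  simp only [sub_mul, Finset.sum_sub_distrib, ← rootFunctional_eq_sum]

theorem InAlcove.rootFunctional_le (hy : InAlcove θ w q k c y) (hθ : IsHighestRoot b θ)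
    (hk : 0 ≤ k) : rootFunctional b i y ≤ q - k := by
  have h1 := hy.sum_nonneg hk (a := fun j => rootCoef b θ j - rootCoef b i j)
    fun j => sub_nonneg.2 (hθ.rootCoef_le i j)
  rw [← rootFunctional_highest_sub] at h1
  linarith [hy.highest_le]

/-- If `w θ` is negative, the sharper bound on `θ` applies. Otherwise `w (θ - α_i)` has positive
height, so `θ - α_i` involves a simple root `α_j` with `w α_j` positive, and this produces the gap.
-/
theorem InAlcove.rootFunctional_lt (hy : InAlcove θ w q k c y) (hθ : IsHighestRoot b θ)
    (hk : 0 ≤ k) (hwi : ¬ b.IsPos (w.perm i)) :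
    rootFunctional b i y ≤ q - k - c - 1 := by
  have ha : ∀ j, 0 ≤ rootCoef b θ j - rootCoef b i j := fun j => sub_nonneg.2 (hθ.rootCoef_le i j)
  have h1 := hy.sum_nonneg hk ha
  rw [← rootFunctional_highest_sub] at h1
  by_cases hwθ : b.IsPos (w.perm θ)
  · obtain ⟨j, -, hj⟩ : ∃ j ∈ Finset.univ,
        0 < (rootCoef b θ j - rootCoef b i j) * b.height (w.perm j) := by
      refine Finset.exists_lt_of_sum_lt ?_
      simp only [sub_mul, Finset.sum_sub_distrib, ← w.height_perm, Finset.sum_const_zero]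
      rw [RootPairing.Base.isPos_iff] at hwθ hwi
      have := b.height_ne_zero (w.perm i)
      omega
    have h2 : 1 ≤ rootCoef b θ j - rootCoef b i j := by
      rcases (ha j).eq_or_lt with h | h
      · rw [← h, zero_mul] at hj
        exact absurd hj (lt_irrefl _)
      · exact h
    have h3 : b.IsPos (w.perm j) := pos_of_mul_pos_right hj (ha j)
    have h4 := hy.le_sum hk ha h2
    rw [← rootFunctional_highest_sub] at h4
    linarith [hy.lt_simple j h3, hy.highest_le]
  · linarith [hy.highest_lt hwθ]

end bounds

/-- Every lattice point is carried into the half-open fundamental alcove. -/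
theorem exists_inAlcove [Finite ι] [P.IsCrystallographic] (hθ : IsHighestRoot b θ) {q : ℤ}
    (hq : 0 < q) (x : coweightLattice b) :
    ∃ (w : LatticeSymmetry b) (t y : coweightLattice b), x = w.map y + q • t ∧
      InAlcove θ w q 0 0 y := by
  have hθ0 : 0 < b.height θ := hθ.isPos
  set h := 1 + b.height θ with hh
  have hh0 : 0 < h := by omega
  have habs := fun i => abs_le.1 (hθ.abs_height_le i)
  -- Scaling by `h` and subtracting `ρ` is a perturbation of `x` off all walls of scale `h q`: the
  -- values become `h α(x) - ht α`, and `0 < |ht α| < h`.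
  obtain ⟨w, t, z, hx, hz, hzθ⟩ := exists_mem_open_alcove b θ hθ0 (mul_pos hh0 hq)
    (h • x - weylCoweight b) (by
      intro i hi
      rw [map_sub, map_smul, ← height_eq_rootFunctional, smul_eq_mul] at hi
      have h1 : h ∣ b.height i := by
        have := dvd_sub (Dvd.intro _ rfl : h ∣ h * rootFunctional b i x)
          ((Dvd.intro _ rfl : h ∣ h * q).trans hi)
        rwa [sub_sub_cancel] at this
      have h2 := Int.le_of_dvd (abs_pos.2 (b.height_ne_zero i)) ((dvd_abs _ _).2 h1)
      have h3 := hθ.abs_height_le i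
      omega)
  let y := w.map.symm (x - q • t)
  -- Undoing the perturbation adds `ht (w α_i)`. Since this is smaller than `h` in absolute value,
  -- integrality turns the open bounds on `z` into weak bounds on `y`, strict exactly as its sign
  -- dictates.
  have hy : ∀ i, h * rootFunctional b i y = rootFunctional b i z + b.height (w.perm i) := by
    intro i
    have h1 : h • (x - q • t) = w.map z + weylCoweight b := by
      rw [smul_sub, smul_smul, eq_add_of_sub_eq hx]
      abel
    rw [w.rootFunctional_map_symm, ← smul_eq_mul, ← map_smul, h1, map_add,
      w.rootFunctional_perm, height_eq_rootFunctional]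
  refine ⟨w, t, y, ?_, ?_, ?_, ?_, ?_⟩
  · simp [y]
  · intro j
    have h1 := hy j
    have h2 := hz j
    have h3 := (habs (w.perm j)).1
    by_contra! h4
    nlinarith
  · intro j hj
    have h1 := hy j
    have h2 := hz j
    have h3 : 0 < b.height (w.perm j) := hj
    by_contra! h4
    nlinarith
  · have h1 := hy θ
    have h3 := (habs (w.perm θ)).2
    by_contra! h4
    nlinarith
  · intro hj
    have h1 := hy θ
    have h3 : b.height (w.perm θ) ≤ 0 := by
      rw [RootPairing.Base.isPos_iff] at hj
      omega
    by_contra! h4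
    nlinarith

/-- The point `w ρ + h t` depends only on the alcove and the translation of `x`. -/
theorem InAlcove.map_weylCoweight_eq (hθ : IsHighestRoot b θ) {q : ℤ} (hq : 0 < q)
    {w w' : LatticeSymmetry b} {t t' y y' : coweightLattice b} (hy : InAlcove θ w q 0 0 y)
    (hy' : InAlcove θ w' q 0 0 y') (hx : w.map y + q • t = w'.map y' + q • t') :
    w.map (weylCoweight b) + (1 + b.height θ) • t =
      w'.map (weylCoweight b) + (1 + b.height θ) • t' := by
  have hθ0 : 0 < b.height θ := hθ.isPos
  set h := 1 + b.height θ with hh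
  have habs := fun i => abs_le.1 (hθ.abs_height_le i)
  -- The other centre seen from the alcove of `(w, t)`; the claim is that it is `ρ` there.
  let u := w.map.symm (w'.map (weylCoweight b) + h • t' - h • t)
  suffices hu : u = weylCoweight b by
    have h1 : w.map u = w'.map (weylCoweight b) + h • t' - h • t := AddEquiv.apply_symm_apply _ _
    rw [hu] at h1
    rw [h1, sub_add_cancel]
  -- The same integer `d`, the value of `w α_i` on `t' - t`, relates `u` to `ρ` at scale `h` and `y`
  -- to `y'` at scale `q`. Bounds on `y` and `y'` therefore limit `d`, and with it `u`.
  have hval : ∀ i, ∃ (i' : ι) (d : ℤ), rootFunctional b i u = b.height i' + h * d ∧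
      rootFunctional b i y - rootFunctional b i' y' = q * d ∧
      w'.perm i' = w.perm i := by
    intro i
    obtain ⟨i', hi'⟩ := w'.perm_surjective (w.perm i)
    refine ⟨i', rootFunctional b (w.perm i) t' - rootFunctional b (w.perm i) t, ?_, ?_, hi'⟩
    · rw [w.rootFunctional_map_symm, map_sub, map_add, ← hi', w'.rootFunctional_perm, map_smul,
        map_smul, smul_eq_mul, smul_eq_mul, height_eq_rootFunctional]
      ring
    · have := congrArg (rootFunctional b (w.perm i)) hx
      rw [map_add, map_add, w.rootFunctional_perm, ← hi', w'.rootFunctional_perm, hi', map_smul,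
        map_smul, smul_eq_mul, smul_eq_mul] at this
      linarith
  have hneg : ∀ i', ¬ b.IsPos i' → b.IsPos (P.reflectionPerm i' i') :=
    fun i' hi' => (isPos_reflectionPerm_self b i').2 hi'
  have hsimple : ∀ j : b.support, 1 ≤ rootFunctional b j u := by
    intro j
    obtain ⟨i, d, h1, h2, h3⟩ := hval j
    rw [h1]
    by_cases hi : b.IsPos i
    -- The weak bounds give only `q d ≥ -q`. Whatever the sign of `w α_j`, one of the two bounds is
    -- strict, which excludes `d = -1`; the other cases below work alike.
    · have hd : 0 ≤ d := by
        by_contra! hd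
        have h4 := hy.le_simple j
        have h5 := hy.lt_simple j
        have h6 := hy'.rootFunctional_le hθ le_rfl (i := i)
        have h7 := hy'.rootFunctional_lt hθ le_rfl (i := i)
        rw [h3] at h7
        by_cases hp : b.IsPos (w.perm j)
        · have := h5 hp
          nlinarith
        · have := h7 hp
          nlinarith
      have : 0 < b.height i := hi
      nlinarith
    · have hd : 1 ≤ d := by
        by_contra! hd
        have h4 := hy.le_simple j
        have h5 := hy.lt_simple j
        have h6 := hy'.le_rootFunctional le_rfl (hneg i hi)
        have h7 := hy'.lt_rootFunctional le_rfl (hneg i hi)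
        rw [w'.isPos_perm_reflectionPerm_self, h3] at h7
        rw [rootFunctional_reflectionPerm_self] at h6 h7
        by_cases hp : b.IsPos (w.perm j)
        · have := h5 hp
          nlinarith
        · have := h7 hp
          nlinarith
      have := (habs i).1
      nlinarith
  have hhigh : rootFunctional b θ u ≤ b.height θ := by
    obtain ⟨i, d, h1, h2, h3⟩ := hval θ
    rw [h1]
    have h4 := hy.highest_le
    have h5 := hy.highest_lt
    by_cases hi : b.IsPos i
    · have hd : d ≤ 0 := by
        by_contra! hd
        have h6 := hy'.le_rootFunctional le_rfl hi
        have h7 := hy'.lt_rootFunctional le_rfl hi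
        rw [h3] at h7
        by_cases hp : b.IsPos (w.perm θ)
        · have := h7 hp
          nlinarith
        · have := h5 hp
          nlinarith
      have := (habs i).2
      nlinarith
    · have hd : d ≤ 1 := by
        by_contra! hd
        have h6 := hy'.rootFunctional_le hθ le_rfl (i := P.reflectionPerm i i)
        have h7 := hy'.rootFunctional_lt hθ le_rfl (i := P.reflectionPerm i i)
        rw [w'.isPos_perm_reflectionPerm_self, h3, not_not] at h7
        rw [rootFunctional_reflectionPerm_self] at h6 h7
        by_cases hp : b.IsPos (w.perm θ)
        · have := h7 hp
          nlinarith
        · have := h5 hp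
          nlinarith
      have : b.height i < 0 := by
        have := b.height_ne_zero i
        rw [RootPairing.Base.isPos_iff] at hi
        omega
      nlinarith
  refine coweightLattice_ext b fun j => ?_
  rw [rootFunctional_weylCoweight_of_mem]
  -- The nonnegative quantities `α_l(u) - 1`, weighted by the positive coefficients of `θ`, sum to
  -- `θ(u) - ht θ ≤ 0`, so all vanish.
  have hterm : ∀ l ∈ Finset.univ, 0 ≤ rootCoef b θ l * (rootFunctional b l u - 1) :=
    fun l _ => mul_nonneg (by linarith [hθ.one_le_rootCoef l]) (by linarith [hsimple l])
  have hsum : ∑ l, rootCoef b θ l * (rootFunctional b l u - 1) ≤ 0 := by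
    simp only [mul_sub, mul_one, Finset.sum_sub_distrib, ← height_eq_sum_rootCoef,
      ← rootFunctional_eq_sum]
    linarith
  have h0 := (Finset.sum_eq_zero_iff_of_nonneg hterm).1
    (le_antisymm hsum (Finset.sum_nonneg hterm)) j (Finset.mem_univ j)
  have := (mul_eq_zero.1 h0).resolve_left (by linarith [hθ.one_le_rootCoef j])
  linarith

end Alcove

/-! ### The bijection between the two point counts -/

section Counting

variable {ι M N : Type*} [AddCommGroup M] [Module ℝ M] [AddCommGroup N] [Module ℝ N]
  {P : RootPairing ι ℝ M N} {b : P.Base} {θ : ι}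

/-- The condition for a lattice point to avoid a truncated affine arrangement modulo `q`. -/
theorem forall_mem_truncatedAffineArrangement {lo hi q : ℤ} {x : coweightLattice b} :
    (∀ p ∈ truncatedAffineArrangement b lo hi, ¬ p.1 x ≡ p.2 [ZMOD q]) ↔
      ∀ i, b.IsPos i → ∀ m, lo ≤ m → m ≤ hi → ¬ q ∣ rootFunctional b i x - m := by
  constructor
  · intro h i hi m h1 h2 hm
    exact h _ ⟨i, hi, m, h1, h2, rfl⟩ (Int.modEq_iff_dvd.2 hm).symm
  · rintro h _ ⟨i, hi, m, h1, h2, rfl⟩ hm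
    exact h i hi m h1 h2 (Int.modEq_iff_dvd.1 hm.symm)

variable [P.IsRootSystem]

/-- Avoiding the levels `1 - k, …, n + k` modulo `q` amounts to keeping a distance from the walls
of the alcove. -/
theorem InAlcove.avoids_iff (hθ : IsHighestRoot b θ) {w : LatticeSymmetry b} {q k n : ℤ}
    (hk : 0 ≤ k) (hn : 0 ≤ n) {t y : coweightLattice b} (hy : InAlcove θ w q 0 0 y) :
    (∀ i, b.IsPos i → ∀ m, 1 - k ≤ m → m ≤ n + k →
      ¬ q ∣ rootFunctional b i (w.map y + q • t) - m) ↔ InAlcove θ w q k n y := by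
  have hval : ∀ i, rootFunctional b (w.perm i) (w.map y + q • t) =
      rootFunctional b i y + q * rootFunctional b (w.perm i) t := by
    intro i
    rw [map_add, w.rootFunctional_perm, map_smul, smul_eq_mul]
  have hneg : ∀ (i : ι) (x : coweightLattice b),
      rootFunctional b (P.reflectionPerm i i) x = -rootFunctional b i x :=
    rootFunctional_reflectionPerm_self b
  constructor
  · intro h
    have hpos : ∀ i, b.IsPos (w.perm i) → ∀ m c, 1 - k ≤ m → m ≤ n + k →
        rootFunctional b i y = m + q * c → False := by
      intro i hi m c h1 h2 h3
      refine h _ hi m h1 h2 ?_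
      rw [hval, h3]
      exact ⟨c + rootFunctional b (w.perm i) t, by ring⟩
    have hnpos : ∀ i, ¬ b.IsPos (w.perm i) → ∀ m c, 1 - k ≤ m → m ≤ n + k →
        rootFunctional b i y = -m + q * c → False := by
      intro i hi m c h1 h2 h3
      refine hpos (P.reflectionPerm i i) ((w.isPos_perm_reflectionPerm_self i).2 hi) m (-c) h1 h2 ?_
      rw [hneg, h3]
      ring
    -- The half-open condition already gives `α_j(y) ≥ 1`, above the bottom of the forbidden
    -- interval, so avoiding it forces `α_j(y)` past its top `n + k`.
    have hlt : ∀ j : b.support, b.IsPos (w.perm j) → k + n + 1 ≤ rootFunctional b j y := by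
      intro j hj
      have h1 := hy.lt_simple j hj
      by_contra! h2
      exact hpos j hj _ 0 (by linarith) (by linarith) (by rw [mul_zero, add_zero])
    have hle : ¬ b.IsPos (w.perm θ) → rootFunctional b θ y ≤ q - k - n - 1 := by
      intro hj
      have h1 := hy.highest_lt hj
      by_contra! h2
      exact hnpos θ hj (q - rootFunctional b θ y) 1 (by linarith) (by linarith) (by ring)
    refine ⟨fun j => ?_, hlt, ?_, hle⟩
    · by_cases hj : b.IsPos (w.perm j)
      · linarith [hlt j hj]
      · have h1 := hy.le_simple j
        by_contra! h2
        exact hnpos j hj (-rootFunctional b j y) 0 (by linarith) (by linarith) (by ring)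
    · by_cases hj : b.IsPos (w.perm θ)
      · have h1 := hy.highest_le
        by_contra! h2
        exact hpos θ hj (rootFunctional b θ y - q) 1 (by linarith) (by linarith) (by ring)
      · linarith [hle hj]
  -- With `i` the image of `j` under `w`, the difference `α_j(y) - m` lies strictly between `0` and
  -- `q` if `j` is positive, and strictly between `-q` and `0` otherwise; neither allows
  -- divisibility by `q`.
  · intro h i hi m h1 h2 hdvd
    obtain ⟨j, rfl⟩ := w.perm_surjective i
    rw [hval, add_sub_right_comm] at hdvd
    have h3 : q ∣ rootFunctional b j y - m :=
      (dvd_add_left (Dvd.intro _ rfl)).1 hdvd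
    have hsmall : ∀ a : ℤ, q ∣ a → 0 < a → a < q → False := fun a h4 h5 h6 =>
      absurd (Int.le_of_dvd h5 h4) (by linarith)
    by_cases hj : b.IsPos j
    · refine hsmall _ h3 ?_ ?_
      · linarith [h.lt_rootFunctional hk hj hi]
      · linarith [h.rootFunctional_le hθ hk (i := j)]
    · have hj' := (isPos_reflectionPerm_self b j).2 hj
      have hwj : ¬ b.IsPos (w.perm (P.reflectionPerm j j)) := by
        rw [w.isPos_perm_reflectionPerm_self, not_not]
        exact hi
      have h4 := h.le_rootFunctional hk hj'
      have h5 := h.rootFunctional_lt hθ hk hwj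
      rw [hneg] at h4 h5
      exact hsmall _ ((dvd_neg).2 h3) (by linarith) (by linarith)

/-- `v` is the image of `ρ` under the symmetry and the `h`-fold translation that carry the
fundamental alcove to the one of `x`. -/
def IsAlcoveCenter (b : P.Base) (θ : ι) (q : ℤ) (x v : coweightLattice b) : Prop :=
  ∃ (w : LatticeSymmetry b) (t y : coweightLattice b), x = w.map y + q • t ∧
    InAlcove θ w q 0 0 y ∧ v = w.map (weylCoweight b) + (1 + b.height θ) • t

theorem IsAlcoveCenter.unique (hθ : IsHighestRoot b θ) {q : ℤ} (hq : 0 < q)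
    {x v v' : coweightLattice b} (h : IsAlcoveCenter b θ q x v) (h' : IsAlcoveCenter b θ q x v') :
    v = v' := by
  obtain ⟨w, t, y, rfl, hy, rfl⟩ := h
  obtain ⟨w', t', y', hx, hy', rfl⟩ := h'
  exact hy.map_weylCoweight_eq hθ hq hy' hx

theorem IsAlcoveCenter.add_smul {q : ℤ} {x v : coweightLattice b}
    (h : IsAlcoveCenter b θ q x v) (s : coweightLattice b) :
    IsAlcoveCenter b θ q (x + q • s) (v + (1 + b.height θ) • s) := by
  obtain ⟨w, t, y, rfl, hy, rfl⟩ := h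
  exact ⟨w, t + s, y, by rw [smul_add, add_assoc], hy, by rw [smul_add, add_assoc]⟩

/-- Moving the point along `ρ` inside its alcove, while the scale changes by `k h`. -/
theorem InAlcove.sub_smul_weylCoweight_iff {w : LatticeSymmetry b} {q k n : ℤ}
    {y : coweightLattice b} :
    InAlcove θ w (q - k * (1 + b.height θ)) 0 n (y - k • weylCoweight b) ↔
      InAlcove θ w q k n y := by
  have h1 : ∀ j : b.support, rootFunctional b j (y - k • weylCoweight b) =
      rootFunctional b j y - k := by
    intro j
    rw [map_sub, map_smul, rootFunctional_weylCoweight_of_mem, smul_eq_mul, mul_one]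
  have h2 : rootFunctional b θ (y - k • weylCoweight b) =
      rootFunctional b θ y - k * b.height θ := by
    rw [map_sub, map_smul, ← height_eq_rootFunctional, smul_eq_mul]
  constructor
  · intro h
    have h3 := h.highest_le
    have h4 := h.highest_lt
    have h5 := h.le_simple
    have h6 := h.lt_simple
    simp only [h1, h2] at h3 h4 h5 h6
    exact ⟨fun j => by linarith [h5 j], fun j hj => by linarith [h6 j hj], by linarith,
      fun hj => by linarith [h4 hj]⟩
  · intro h
    refine ⟨fun j => ?_, fun j hj => ?_, ?_, fun hj => ?_⟩
    · linarith [h.le_simple j, h1 j]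
    · linarith [h.lt_simple j hj, h1 j]
    · linarith [h.highest_le]
    · linarith [h.highest_lt hj]

/-- The shift by `k h` on the level of point counts. -/
theorem ncard_modComplement_shift [Finite ι] [P.IsCrystallographic] (hθ : IsHighestRoot b θ)
    (n k : ℕ) {q q' : ℕ} (hq' : 0 < q') (hqq' : (q' : ℤ) = q - k * (1 + b.height θ)) :
    (modComplement (truncatedAffineArrangement b (1 - k) (n + k)) q).ncard =
      (modComplement (truncatedAffineArrangement b 1 n) q').ncard := by
  have hθ0 : 0 < b.height θ := hθ.isPos
  have hq : 0 < q := by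
    have : (0 : ℤ) ≤ k * (1 + b.height θ) := by positivity
    omega
  have hex : ∀ q : ℕ, 0 < q → ∃ v : coweightLattice b → coweightLattice b,
      ∀ x, IsAlcoveCenter b θ q x (v x) := by
    intro q hq
    refine Classical.skolem.1 fun x => ?_
    obtain ⟨w, t, y, hx, hy⟩ := exists_inAlcove hθ (Int.natCast_pos.2 hq) x
    exact ⟨_, w, t, y, hx, hy, rfl⟩
  have huniq : ∀ {q : ℕ}, 0 < q → ∀ {x v v'}, IsAlcoveCenter b θ q x v →
      IsAlcoveCenter b θ q x v' → v = v' := fun hq =>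
    IsAlcoveCenter.unique hθ (Int.natCast_pos.2 hq)
  obtain ⟨v, hv⟩ := hex q hq
  obtain ⟨v', hv'⟩ := hex q' hq'
  refine ncard_mk_image_eq_of_inverse (fun x => x - (k : ℤ) • v x) (fun x => x + (k : ℤ) • v' x)
    ?_ ?_ ?_ ?_
  · intro x t
    rw [huniq hq (hv _) ((hv x).add_smul t), hqq']
    module
  · intro x t
    rw [huniq hq' (hv' _) ((hv' x).add_smul t), hqq']
    module
  · intro x hx
    rw [forall_mem_truncatedAffineArrangement] at hx ⊢
    obtain ⟨w, t, y, rfl, hy, hvx⟩ := hv x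
    rw [hy.avoids_iff hθ (Int.natCast_nonneg k) (Int.natCast_nonneg n),
      ← InAlcove.sub_smul_weylCoweight_iff, ← hqq'] at hx
    have h1 : w.map y + (q : ℤ) • t - (k : ℤ) • v (w.map y + (q : ℤ) • t) =
        w.map (y - (k : ℤ) • weylCoweight b) + (q' : ℤ) • t := by
      rw [hvx, map_sub, map_zsmul, hqq']
      module
    have hy' := hx.mono le_rfl (Int.natCast_nonneg n)
    simp only [h1]
    refine ⟨?_, ?_⟩
    · have := (hy'.avoids_iff hθ le_rfl (Int.natCast_nonneg n) (t := t)).2 hx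
      simpa using this
    · rw [huniq hq' (hv' _) ⟨w, t, _, rfl, hy', rfl⟩, map_sub, map_zsmul, hqq']
      module
  · intro x hx
    rw [forall_mem_truncatedAffineArrangement] at hx ⊢
    obtain ⟨w, t, y, rfl, hy, hvx⟩ := hv' x
    have h0 : InAlcove θ w q' 0 n y := by
      rw [← hy.avoids_iff hθ le_rfl (Int.natCast_nonneg n) (t := t)]
      simpa using hx
    have h1 : w.map y + (q' : ℤ) • t + (k : ℤ) • v' (w.map y + (q' : ℤ) • t) =
        w.map (y + (k : ℤ) • weylCoweight b) + (q : ℤ) • t := by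
      rw [hvx, map_add, map_zsmul, hqq']
      module
    have hx' : InAlcove θ w q k n (y + (k : ℤ) • weylCoweight b) := by
      rw [← InAlcove.sub_smul_weylCoweight_iff, ← hqq', add_sub_cancel_right]
      exact h0
    have hy' := hx'.mono (Int.natCast_nonneg k) (Int.natCast_nonneg n)
    simp only [h1]
    refine ⟨?_, ?_⟩
    · exact (hy'.avoids_iff hθ (Int.natCast_nonneg k) (Int.natCast_nonneg n)).2 hx'
    · rw [huniq hq (hv _) ⟨w, t, _, rfl, hy', rfl⟩, map_add, map_zsmul, hqq']
      module

end Counting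

/-! ### The shift theorem -/

/-- Shift reduction: the characteristic quasi-polynomials of the arrangements with levels in
`[1, n]` and in `[1 - k, n + k]` exist, and the second is the first shifted by `k h`. -/
theorem theorem4p3 {ι M N : Type*} [Finite ι] [AddCommGroup M] [Module ℝ M]
    [AddCommGroup N] [Module ℝ N] (P : RootPairing ι ℝ M N) [P.IsRootSystem]
    [P.IsCrystallographic] [P.IsReduced] [P.IsIrreducible] (b : P.Base)
    (n k : ℕ) (hn : 1 ≤ n) :
    IsCharQuasiPolynomial (truncatedAffineArrangement b 1 n)
        (charQuasiPolynomial (truncatedAffineArrangement b 1 n)) ∧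
      IsCharQuasiPolynomial (truncatedAffineArrangement b (1 - k) (n + k))
        (charQuasiPolynomial (truncatedAffineArrangement b (1 - k) (n + k))) ∧
      ∀ q : ℤ,
        charQuasiPolynomial (truncatedAffineArrangement b (1 - k) (n + k)) q =
          charQuasiPolynomial (truncatedAffineArrangement b 1 n) (q - k * coxeterNumber b) := by
  obtain ⟨hfree, hfinite⟩ := coweightLattice_free_finite b
  have h1 := isCharQuasiPolynomial_charQuasiPolynomial (truncatedAffineArrangement_finite b 1 n)
  have h2 := isCharQuasiPolynomial_charQuasiPolynomial
    (truncatedAffineArrangement_finite b (1 - k) (n + k))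
  refine ⟨h1, h2, ?_⟩
  obtain ⟨θ, hθ⟩ := exists_highestRoot b
  obtain ⟨q₁, hq₁⟩ := h1.2
  obtain ⟨q₂, hq₂⟩ := h2.2
  have hθ0 : 0 < b.height θ := hθ.isPos
  rw [hθ.coxeterNumber_eq]
  have hpos : (0 : ℤ) ≤ k * (1 + b.height θ) := by positivity
  -- The threshold makes `q` exceed `q₂` and `q - k h` exceed `q₁`, so that both quasi-polynomials
  -- are actual counts.
  refine h1.1.eq_shift h2.1 _ (q₁ + q₂ + (k * (1 + b.height θ)).toNat) fun q hq => ?_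
  obtain ⟨q', hq'⟩ : ∃ q' : ℕ, (q' : ℤ) = q - k * (1 + b.height θ) :=
    ⟨(q - k * (1 + b.height θ)).toNat, Int.toNat_of_nonneg (by omega)⟩
  rw [← (hq₂ q (by omega)).2, ← hq', ← (hq₁ q' (by omega)).2,
    ncard_modComplement_shift hθ n k (by omega) hq']
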